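/- Let $V$ be a complete discrete valuation ring with uniformizer $\pi$ and fraction field $K$; fix $0<\epsilon<1$ and put $|\pi|=\epsilon$. Tensor products are over $V$. A (convex) bornology on a $V$-module is a family of subsets, called bounded, that contains the finite subsets and is closed under subsets, finite unions and passing to generated $V$-submodules. In the fine bornology, the bounded subsets are those contained in finitely generated submodules. A tensor product $X\otimes Y$ carries the bornology generated by the images of $P\otimes Q$ for bounded submodules $P\subseteq X$, $Q\subseteq Y$. A sequence $(x_n)$ is $S$-convergent to $x$ if there are $\delta_n\in V$ with $\delta_n\to0$ and $x_n-x\in\delta_nS$ for all $n$; it is $S$-Cauchy if there are $\delta_n\in V$ with $\delta_n\to0$ and $x_n-x_m\in\delta_lS$ whenever $n,m\ge l$. A bornological module is complete if limits of sequences that are $S$-convergent for bounded $S$ are unique, and if for every bounded $S$ there is a bounded $S'$ such that every $S$-Cauchy sequence is $S'$-convergent to some limit. The completion of a bornological module $X$ is a complete bornological module with a bounded linear map from $X$ that is universal among bounded linear maps from $X$ to complete bornological modules. Let $R$ be a finitely generated commutative $V$-algebra with the fine bornology, let $J\subseteq R$ be an ideal with $\pi\in J$, and let $\alpha\in\mathbb{Q}\cap[0,1]$.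 For a $V$-submodule $M$ of a $K$-vector space and $r>0$, put $r\star M=\pi^{\lceil\log_\epsilon r\rceil}M$. The spectral radius $\varrho(M;\mathcal C)$ of a $V$-submodule $M$ of a $K$-algebra with a bornology $\mathcal C$ is the infimum in $[0,\infty]$ of all $r>0$ for which $\sum_{n\ge0}r^{-n}\star M^n$ is bounded. Let $\mathcal B_{J,\alpha}$ be the smallest $K$-vector space bornology on $R_K=K\otimes R$ (that is, a bornology for which multiplication by $\pi^{-1}$ is bounded) such that $\varrho(M;\mathcal B_{J,\alpha})\le\epsilon^\alpha$ for the image in $R_K$ of every bounded $V$-submodule $M\subseteq J$. The $\alpha$-tube algebra of $R$ around $J$ is the $V$-subalgebra $$T=\sum_{n\ge0}\epsilon^{-\alpha n}\star J^n\subseteq R_K ,\qquad J^0=R,$$ where $J^n$ is identified with its image in $R_K$. The Monsky–Washnitzer completion $T^\dagger$ is the subalgebra of the $\pi$-adic completion $\varprojlim_j T/\pi^jT$ of all elements $z=\sum_{j\ge0}\pi^jw_j$ with $w_j\in M^{\kappa_j}$ for some finitely generated $V$-submodule $M\subseteq T$ with $1\in M$, and $\kappa_j\in\mathbb N$, $\kappa_j\le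 c(j+1)$, for some constant $c>0$. A subset of $T^\dagger$ is bounded if all its elements are of this form with the same $M$ and $c$. Equip $K\otimes T^\dagger$ with the tensor product of the fine bornology on $K$ and this bornology. Then $K\otimes T^\dagger$ is a bornological $K$-algebra (multiplication, and multiplication by $\pi^{-1}$, are bounded), and the $K$-algebra homomorphism $R_K\to K\otimes T^\dagger$ induced by $R\to T\to T^\dagger$ is a completion of the bornological module $(R_K,\mathcal B_{J,\alpha})$. In other words, the completion of $(R_K,\mathcal B_{J,\alpha})$ is $K\otimes T^\dagger$ as a bornological $K$-algebra. -/

import Mathlib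

open scoped TensorProduct Pointwise

universe w

namespace BornTube

/-! ### Bornological modules -/

section Bornologies

/-- A (convex) bornology on a `V`-module: a bornology for which the `V`-submodule generated by a
bounded subset is bounded. -/
structure ConvexBornology (V M : Type*) [CommRing V] [AddCommGroup M] [Module V M]
    extends Bornology M where
  isBounded_span : ∀ S : Set M, @Bornology.IsBounded M toBornology S →
    @Bornology.IsBounded M toBornology (Submodule.span V S : Set M)

variable {V : Type*} [CommRing V]
variable {M : Type*} [AddCommGroup M] [Module V M]
variable {N : Type*} [AddCommGroup N] [Module V N]

namespace ConvexBornology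

/-- The bounded subsets. -/
def Bounded (B : ConvexBornology V M) (S : Set M) : Prop :=
  @Bornology.IsBounded M B.toBornology S

/-- Constructor from the family of bounded subsets. -/
def ofBounded (P : Set M → Prop) (hempty : P ∅)
    (hsub : ∀ S, P S → ∀ T, T ⊆ S → P T)
    (hunion : ∀ S, P S → ∀ T, P T → P (S ∪ T))
    (hsingle : ∀ x, P {x})
    (hspan : ∀ S, P S → P (Submodule.span V S : Set M)) : ConvexBornology V M where
  toBornology := Bornology.ofBounded {S | P S} hempty hsub hunion hsingle
  isBounded_span := by
    intro S hS
    rw [Bornology.isBounded_ofBounded_iff] at hS ⊢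
    exact hspan S hS

theorem bounded_ofBounded_iff {P : Set M → Prop} {hempty : P ∅}
    {hsub : ∀ S, P S → ∀ T, T ⊆ S → P T}
    {hunion : ∀ S, P S → ∀ T, P T → P (S ∪ T)}
    {hsingle : ∀ x, P {x}}
    {hspan : ∀ S, P S → P (Submodule.span V S : Set M)} {S : Set M} :
    (ofBounded P hempty hsub hunion hsingle hspan).Bounded S ↔ P S :=
  Bornology.isBounded_ofBounded_iff {S | P S} (sUnion_univ := hsingle)

theorem Bounded.subset {B : ConvexBornology V M} {S T : Set M} (h : B.Bounded S) (hT : T ⊆ S) :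
    B.Bounded T :=
  @Bornology.IsBounded.subset M B.toBornology _ _ h hT

theorem Bounded.union {B : ConvexBornology V M} {S T : Set M} (h : B.Bounded S)
    (hT : B.Bounded T) : B.Bounded (S ∪ T) :=
  @Bornology.IsBounded.union M B.toBornology _ _ h hT

theorem Bounded.span {B : ConvexBornology V M} {S : Set M} (h : B.Bounded S) :
    B.Bounded (Submodule.span V S : Set M) :=
  B.isBounded_span S h

theorem bounded_empty (B : ConvexBornology V M) : B.Bounded ∅ :=
  @Bornology.isBounded_empty M B.toBornology

theorem bounded_singleton (B : ConvexBornology V M) (x : M) : B.Bounded {x} :=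
  @Bornology.isBounded_singleton M B.toBornology x

theorem Bounded.sup {B : ConvexBornology V M} {P Q : Submodule V M}
    (hP : B.Bounded (P : Set M)) (hQ : B.Bounded (Q : Set M)) :
    B.Bounded ((P ⊔ Q : Submodule V M) : Set M) := by
  have h := (hP.union hQ).span
  rwa [Submodule.span_union, Submodule.span_eq, Submodule.span_eq] at h

/-- The fine bornology: subsets of finitely generated submodules. -/
def fine (V M : Type*) [CommRing V] [AddCommGroup M] [Module V M] : ConvexBornology V M :=
  ofBounded (fun S => ∃ P : Submodule V M, P.FG ∧ S ⊆ P)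
    ⟨⊥, Submodule.fg_bot, Set.empty_subset _⟩
    (fun _ ⟨P, hP, hS⟩ _ hT => ⟨P, hP, hT.trans hS⟩)
    (fun _ ⟨P, hP, hS⟩ _ ⟨Q, hQ, hT⟩ => ⟨P ⊔ Q, hP.sup hQ, Set.union_subset
      (hS.trans (SetLike.coe_subset_coe.2 le_sup_left))
      (hT.trans (SetLike.coe_subset_coe.2 le_sup_right))⟩)
    (fun x => ⟨Submodule.span V {x}, Submodule.fg_span_singleton x, Submodule.subset_span⟩)
    (fun _ ⟨P, hP, hS⟩ => ⟨P, hP, SetLike.coe_subset_coe.2 (Submodule.span_le.2 hS)⟩)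

/-- The intersection of a family of bornologies: a subset is bounded if it is bounded for every
member of the family. -/
def inter (F : Set (ConvexBornology V M)) : ConvexBornology V M :=
  ofBounded (fun S => ∀ B ∈ F, B.Bounded S)
    (fun B _ => B.bounded_empty)
    (fun _ h _ hT B hB => (h B hB).subset hT)
    (fun _ h _ h' B hB => (h B hB).union (h' B hB))
    (fun x B _ => B.bounded_singleton x)
    (fun _ h B hB => (h B hB).span)

/-- The bornological tensor product: a subset of `M ⊗ N` is bounded if it is contained in the image
of `P ⊗ Q` for bounded submodules `P ⊆ M` and `Q ⊆ N`. -/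
def tensor (B : ConvexBornology V M) (C : ConvexBornology V N) :
    ConvexBornology V (M ⊗[V] N) :=
  ofBounded (fun S => ∃ (P : Submodule V M) (Q : Submodule V N),
      B.Bounded (P : Set M) ∧ C.Bounded (Q : Set N) ∧
        S ⊆ LinearMap.range (TensorProduct.mapIncl P Q))
    ⟨Submodule.span V ∅, Submodule.span V ∅, B.bounded_empty.span, C.bounded_empty.span,
      Set.empty_subset _⟩
    (fun _ ⟨P, Q, hP, hQ, hS⟩ _ hT => ⟨P, Q, hP, hQ, hT.trans hS⟩)
    (fun _ ⟨P, Q, hP, hQ, hS⟩ _ ⟨P', Q', hP', hQ', hT⟩ =>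
      ⟨P ⊔ P', Q ⊔ Q', hP.sup hP', hQ.sup hQ', Set.union_subset
        (hS.trans (SetLike.coe_subset_coe.2
          (TensorProduct.range_mapIncl_mono le_sup_left le_sup_left)))
        (hT.trans (SetLike.coe_subset_coe.2
          (TensorProduct.range_mapIncl_mono le_sup_right le_sup_right)))⟩)
    (fun x => by
      induction x using TensorProduct.induction_on with
      | zero =>
        exact ⟨Submodule.span V ∅, Submodule.span V ∅, B.bounded_empty.span,
          C.bounded_empty.span, Set.singleton_subset_iff.2 (Submodule.zero_mem _)⟩
      | tmul m n =>
        refine ⟨Submodule.span V {m}, Submodule.span V {n}, (B.bounded_singleton m).span,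
          (C.bounded_singleton n).span, Set.singleton_subset_iff.2 ⟨
            ⟨m, Submodule.mem_span_singleton_self m⟩ ⊗ₜ
              ⟨n, Submodule.mem_span_singleton_self n⟩, ?_⟩⟩
        simp [TensorProduct.mapIncl]
      | add x y hx hy =>
        obtain ⟨P, Q, hP, hQ, hS⟩ := hx
        obtain ⟨P', Q', hP', hQ', hT⟩ := hy
        refine ⟨P ⊔ P', Q ⊔ Q', hP.sup hP', hQ.sup hQ', Set.singleton_subset_iff.2 ?_⟩
        exact Submodule.add_mem _
          (TensorProduct.range_mapIncl_mono le_sup_left le_sup_left (hS rfl))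
          (TensorProduct.range_mapIncl_mono le_sup_right le_sup_right (hT rfl)))
    (fun _ ⟨P, Q, hP, hQ, hS⟩ =>
      ⟨P, Q, hP, hQ, SetLike.coe_subset_coe.2 (Submodule.span_le.2 hS)⟩)

end ConvexBornology

/-- A map is bounded if it maps bounded subsets to bounded subsets. -/
def IsBoundedMap (B : ConvexBornology V M) (C : ConvexBornology V N) (f : M → N) : Prop :=
  ∀ S : Set M, B.Bounded S → C.Bounded (f '' S)

/-! ### Convergence, completeness, completions.
Throughout, `ϖ` is a generator of the maximal ideal of `V`. -/

/-- The sequence `δ` converges to `0` in the `ϖ`-adic topology on `V`. -/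
def TendstoZeroAdic (ϖ : V) (δ : ℕ → V) : Prop :=
  ∀ k : ℕ, ∀ᶠ n in Filter.atTop, ϖ ^ k ∣ δ n

/-- The sequence `x` is `S`-convergent to `y`. -/
def SConverges (ϖ : V) (S : Set M) (x : ℕ → M) (y : M) : Prop :=
  ∃ δ : ℕ → V, TendstoZeroAdic ϖ δ ∧ ∀ n, x n - y ∈ δ n • S

/-- The sequence `x` is `S`-Cauchy. -/
def SCauchy (ϖ : V) (S : Set M) (x : ℕ → M) : Prop :=
  ∃ δ : ℕ → V, TendstoZeroAdic ϖ δ ∧ ∀ n m l : ℕ, l ≤ n → l ≤ m → x n - x m ∈ δ l • S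

/-- A bornological module is separated if limits of convergent sequences are unique. -/
def IsSeparated (ϖ : V) (B : ConvexBornology V M) : Prop :=
  ∀ (x : ℕ → M) (y z : M) (S T : Set M), B.Bounded S → B.Bounded T →
    SConverges ϖ S x y → SConverges ϖ T x z → y = z

/-- A bornological module is complete if it is separated and for every bounded `S` there is a
bounded `S'` such that all `S`-Cauchy sequences are `S'`-convergent. -/
def IsCompleteBorn (ϖ : V) (B : ConvexBornology V M) : Prop :=
  IsSeparated ϖ B ∧ ∀ S : Set M, B.Bounded S → ∃ S' : Set M, B.Bounded S' ∧
    ∀ x : ℕ → M, SCauchy ϖ S x → ∃ y : M, SConverges ϖ S' x y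

/-- The map `ι : (M, B) → (N, C)` is a completion of the bornological module `(M, B)`: the target
is complete, `ι` is bounded, and any bounded linear map from `(M, B)` to a complete bornological
module factors uniquely through `ι` by a bounded linear map. -/
structure IsCompletion (ϖ : V) (B : ConvexBornology V M) (C : ConvexBornology V N)
    (ι : M →ₗ[V] N) : Prop where
  complete : IsCompleteBorn ϖ C
  bounded : IsBoundedMap B C ι
  universal : ∀ (Y : Type w) [AddCommGroup Y] [Module V Y] (D : ConvexBornology V Y),
    IsCompleteBorn ϖ D → ∀ f : M →ₗ[V] Y, IsBoundedMap B D f →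
      ∃! g : N →ₗ[V] Y, IsBoundedMap C D g ∧ g ∘ₗ ι = f

/-- The bornology `B` makes `A` a bornological algebra: products of bounded subsets are bounded. -/
def IsAlgebraBornology {A : Type*} [Ring A] [Algebra V A] (B : ConvexBornology V A) : Prop :=
  ∀ S T : Set A, B.Bounded S → B.Bounded T → B.Bounded (S * T)

/-- The bornology `B` makes the `K`-vector space `X` a bornological `K`-vector space:
multiplication by the inverse of `ϖ` is bounded. -/
def IsVectorSpaceBornology (K : Type*) [Field K] [Algebra V K] {X : Type*} [AddCommGroup X]
    [Module V X] [Module K X] (ϖ : V) (B : ConvexBornology V X) : Prop :=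
  ∀ S : Set X, B.Bounded S → B.Bounded ((algebraMap V K ϖ)⁻¹ • S)

end Bornologies

/-! ### Spectral radius -/

section SpectralRadius

variable {V : Type*} [CommRing V] (K : Type*) [Field K] [Algebra V K]

/-- `r ⋆ M = ϖ ^ ⌈log_ε r⌉ • M`. -/
noncomputable def star {X : Type*} [AddCommGroup X] [Module V X] [Module K X]
    [IsScalarTower V K X] (ϖ : V) (ε r : ℝ) (M : Submodule V X) : Submodule V X :=
  (algebraMap V K ϖ ^ ⌈Real.logb ε r⌉) • M

/-- The submodule `∑ₙ r⁻ⁿ ⋆ Mⁿ` of all finite sums of elements of the `r⁻ⁿ ⋆ Mⁿ`, `n ∈ ℕ`. -/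
noncomputable def geomSum {A : Type*} [Ring A] [Algebra V A] [Algebra K A]
    [IsScalarTower V K A] (ϖ : V) (ε r : ℝ) (M : Submodule V A) : Submodule V A :=
  ⨆ n : ℕ, star K ϖ ε (r ^ n)⁻¹ (M ^ n)

/-- The spectral radius of a submodule `M` of a bornological `K`-algebra: the infimum in `[0, ∞]`
of all `r > 0` for which `∑ₙ r⁻ⁿ ⋆ Mⁿ` is bounded. -/
noncomputable def bornSpectralRadius {A : Type*} [Ring A] [Algebra V A] [Algebra K A]
    [IsScalarTower V K A] (ϖ : V) (ε : ℝ) (B : ConvexBornology V A) (M : Submodule V A) :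
    ENNReal :=
  ⨅ (r : ℝ) (_ : 0 < r ∧ B.Bounded (geomSum K ϖ ε r M : Set A)), ENNReal.ofReal r

end SpectralRadius

/-! ### The bornology attached to an ideal and `α`, and the `α`-tube algebra.
Here `R_K = R ⊗ K` is written `K ⊗[V] R`. -/

section Tube

variable {V : Type*} [CommRing V] (K : Type*) [Field K] [Algebra V K]
variable {R : Type*} [CommRing R] [Algebra V R]

/-- The image in `R_K` of a `V`-submodule of `R`. -/
noncomputable def imageK (M : Submodule V R) : Submodule V (K ⊗[V] R) :=
  M.map (Algebra.TensorProduct.includeRight : R →ₐ[V] K ⊗[V] R).toLinearMap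

/-- The smallest `K`-vector space bornology on `R_K` for which all `V`-submodules `M ⊆ J` that are
bounded in `R` have spectral radius at most `ε ^ α`. -/
noncomputable def alphaBornology (ϖ : V) (ε : ℝ) (B : ConvexBornology V R) (J : Ideal R)
    (α : ℝ) : ConvexBornology V (K ⊗[V] R) :=
  ConvexBornology.inter {C | IsVectorSpaceBornology K ϖ C ∧
    ∀ M : Submodule V R, M ≤ J.restrictScalars V → B.Bounded (M : Set R) →
      bornSpectralRadius K ϖ ε C (imageK K M) ≤ ENNReal.ofReal (ε ^ α)}

/-- The summand `ε ^ (-α n) ⋆ J ^ n` of the tube algebra, where `J ^ 0 = R`. -/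
noncomputable def tubeSummand (ϖ : V) (ε : ℝ) (J : Ideal R) (α : ℝ) (n : ℕ) :
    Submodule V (K ⊗[V] R) :=
  star K ϖ ε (ε ^ (-(α * n))) (imageK K ((J ^ n).restrictScalars V))

theorem tubeSummand_eq {ϖ : V} {ε : ℝ} (hε0 : 0 < ε) (hε1 : ε < 1) (J : Ideal R) (α : ℝ) (n : ℕ) :
    tubeSummand K ϖ ε J α n =
      (algebraMap V K ϖ ^ ⌈-(α * n)⌉) • imageK K ((J ^ n).restrictScalars V) := by
  rw [tubeSummand, star, Real.logb_rpow hε0 hε1.ne]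

theorem tubeSummand_mul_le [IsDomain V] [IsFractionRing V K] {ϖ : V} (hϖ : Irreducible ϖ) {ε : ℝ}
    (hε0 : 0 < ε) (hε1 : ε < 1) (J : Ideal R) (α : ℝ) (m n : ℕ) :
    tubeSummand K ϖ ε J α m * tubeSummand K ϖ ε J α n ≤ tubeSummand K ϖ ε J α (m + n) := by
  have hp : algebraMap V K ϖ ≠ 0 := by
    simpa using hϖ.ne_zero
  simp only [tubeSummand_eq K hε0 hε1]
  rw [Submodule.mul_le]
  intro x hx y hy
  obtain ⟨x', hx', rfl⟩ := (Submodule.mem_smul_pointwise_iff_exists _ _ _).1 hx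
  obtain ⟨y', hy', rfl⟩ := (Submodule.mem_smul_pointwise_iff_exists _ _ _).1 hy
  obtain ⟨a, ha, rfl⟩ := hx'
  obtain ⟨b, hb, rfl⟩ := hy'
  have hle : ⌈-(α * ((m + n : ℕ) : ℝ))⌉ ≤ ⌈-(α * (m : ℝ))⌉ + ⌈-(α * (n : ℝ))⌉ := by
    refine le_trans (le_of_eq ?_) (Int.ceil_add_le _ _)
    congr 1
    push_cast
    ring
  obtain ⟨d, hd⟩ := Int.le.dest hle
  refine (Submodule.mem_smul_pointwise_iff_exists _ _ _).2
    ⟨_, ⟨ϖ ^ d • (a * b), ?_, rfl⟩, ?_⟩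
  · refine Submodule.smul_mem _ _ ?_
    change a * b ∈ J ^ (m + n)
    rw [pow_add]
    exact Ideal.mul_mem_mul ha hb
  · simp only [AlgHom.toLinearMap_apply, map_smul, map_mul]
    rw [smul_mul_smul_comm, ← zpow_add₀ hp, ← hd, zpow_add₀ hp, zpow_natCast, ← map_pow,
      mul_smul, algebraMap_smul]

theorem includeRight_mem_tubeSummand_zero {ϖ : V} {ε : ℝ} (hε0 : 0 < ε) (hε1 : ε < 1)
    (J : Ideal R) (α : ℝ) (a : R) :
    (Algebra.TensorProduct.includeRight : R →ₐ[V] K ⊗[V] R) a ∈ tubeSummand K ϖ ε J α 0 := by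
  rw [tubeSummand_eq K hε0 hε1]
  refine (Submodule.mem_smul_pointwise_iff_exists _ _ _).2 ⟨_, ⟨a, ?_, rfl⟩, ?_⟩
  · simp
  · simp

/-- The `α`-tube algebra `∑ₙ ε ^ (-α n) ⋆ J ^ n ⊆ R_K` of `R` around `J`. -/
noncomputable def tube [IsDomain V] [IsFractionRing V K] {ϖ : V} (hϖ : Irreducible ϖ) {ε : ℝ}
    (hε0 : 0 < ε) (hε1 : ε < 1) (J : Ideal R) (α : ℝ) : Subalgebra V (K ⊗[V] R) :=
  (⨆ n : ℕ, tubeSummand K ϖ ε J α n).toSubalgebra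
    (by
      have h := includeRight_mem_tubeSummand_zero K (ϖ := ϖ) hε0 hε1 J α 1
      rw [map_one] at h
      exact Submodule.mem_iSup_of_mem 0 h)
    (by
      intro x y hx hy
      have h : (⨆ n : ℕ, tubeSummand K ϖ ε J α n) * (⨆ n : ℕ, tubeSummand K ϖ ε J α n) ≤
          ⨆ n : ℕ, tubeSummand K ϖ ε J α n := by
        rw [Submodule.iSup_mul]
        refine iSup_le fun m => ?_
        rw [Submodule.mul_iSup]
        exact iSup_le fun n => (tubeSummand_mul_le K hϖ hε0 hε1 J α m n).trans
          (le_iSup (tubeSummand K ϖ ε J α) (m + n))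
      exact h (Submodule.mul_mem_mul hx hy))

/-- The canonical homomorphism from `R` to its `α`-tube algebra around `J`. -/
noncomputable def toTube [IsDomain V] [IsFractionRing V K] {ϖ : V} (hϖ : Irreducible ϖ) {ε : ℝ}
    (hε0 : 0 < ε) (hε1 : ε < 1) (J : Ideal R) (α : ℝ) : R →ₐ[V] tube K hϖ hε0 hε1 J α :=
  (Algebra.TensorProduct.includeRight : R →ₐ[V] K ⊗[V] R).codRestrict _
    (fun a => (Submodule.mem_iSup_of_mem 0
      (includeRight_mem_tubeSummand_zero K hε0 hε1 J α a) :
        _ ∈ ⨆ n : ℕ, tubeSummand K ϖ ε J α n))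

end Tube

/-! ### The Monsky–Washnitzer completion -/

section Dagger

variable {V : Type*} [CommRing V] (ϖ : V) (A : Type*) [CommRing A] [Algebra V A]

/-- The `ϖ`-adic completion `lim A / ϖ ^ j A`. -/
abbrev AdicHat : Type _ :=
  AdicCompletion (Ideal.span {algebraMap V A ϖ}) A

variable {A}

/-- `z = ∑ⱼ ϖ ^ j w_j` with `w_j ∈ M ^ κ_j` and `κ_j ≤ c (j + 1)` for all `j`. -/
def IsMWSum (M : Submodule V A) (c : ℝ) (z : AdicHat ϖ A) : Prop :=
  ∃ (κ : ℕ → ℕ) (x : ℕ → A), (∀ j, (κ j : ℝ) ≤ c * (j + 1)) ∧ (∀ j, x j ∈ M ^ κ j) ∧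
    ∀ n : ℕ, AdicCompletion.evalₐ (Ideal.span {algebraMap V A ϖ}) n z =
      Ideal.Quotient.mk _ (∑ j ∈ Finset.range n, ϖ ^ j • x j)

variable {ϖ}

theorem pow_le_pow_of_one_mem {M : Submodule V A} (h1 : (1 : A) ∈ M) {m n : ℕ} (h : m ≤ n) :
    M ^ m ≤ M ^ n :=
  pow_le_pow_right₀ (Submodule.one_le.2 h1) h

theorem IsMWSum.mono {M M' : Submodule V A} {c c' : ℝ} {z : AdicHat ϖ A} (h : IsMWSum ϖ M c z)
    (hM : M ≤ M') (hc : c ≤ c') : IsMWSum ϖ M' c' z := by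
  obtain ⟨κ, x, hκ, hx, hz⟩ := h
  exact ⟨κ, x, fun j => (hκ j).trans (by gcongr), fun j => pow_le_pow_left' hM _ (hx j), hz⟩

theorem IsMWSum.zero (M : Submodule V A) {c : ℝ} (hc : 0 ≤ c) :
    IsMWSum ϖ M c (0 : AdicHat ϖ A) :=
  ⟨fun _ => 0, fun _ => 0, fun j => by push_cast; positivity, fun _ => Submodule.zero_mem _,
    fun n => by simp⟩

theorem IsMWSum.add {M : Submodule V A} (h1 : (1 : A) ∈ M) {c : ℝ} {z z' : AdicHat ϖ A}
    (h : IsMWSum ϖ M c z) (h' : IsMWSum ϖ M c z') : IsMWSum ϖ M c (z + z') := by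
  obtain ⟨κ, x, hκ, hx, hz⟩ := h
  obtain ⟨κ', x', hκ', hx', hz'⟩ := h'
  refine ⟨fun j => max (κ j) (κ' j), fun j => x j + x' j, fun j => ?_, fun j => ?_, fun n => ?_⟩
  · push_cast
    exact max_le (hκ j) (hκ' j)
  · exact Submodule.add_mem _ (pow_le_pow_of_one_mem h1 (le_max_left _ _) (hx j))
      (pow_le_pow_of_one_mem h1 (le_max_right _ _) (hx' j))
  · rw [map_add, hz, hz', ← map_add, ← Finset.sum_add_distrib]
    simp only [smul_add]

theorem evalₐ_algebraMap (v : V) (n : ℕ) :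
    AdicCompletion.evalₐ (Ideal.span {algebraMap V A ϖ}) n
      (algebraMap V (AdicHat ϖ A) v) = Ideal.Quotient.mk _ (algebraMap V A v) := by
  rfl

theorem IsMWSum.smul {M : Submodule V A} {c : ℝ} (v : V) {z : AdicHat ϖ A}
    (h : IsMWSum ϖ M c z) : IsMWSum ϖ M c (v • z) := by
  obtain ⟨κ, x, hκ, hx, hz⟩ := h
  refine ⟨κ, fun j => v • x j, hκ, fun j => Submodule.smul_mem _ _ (hx j), fun n => ?_⟩
  rw [Algebra.smul_def, map_mul, hz, evalₐ_algebraMap, ← map_mul, ← Algebra.smul_def,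
    Finset.smul_sum]
  simp only [smul_comm v]

theorem IsMWSum.mul {M M' : Submodule V A} (h1 : (1 : A) ∈ M) (h1' : (1 : A) ∈ M') {c c' : ℝ}
    (hc : 0 < c) (hc' : 0 < c') {z z' : AdicHat ϖ A} (h : IsMWSum ϖ M c z)
    (h' : IsMWSum ϖ M' c' z') : IsMWSum ϖ (M ⊔ M') (c + c') (z * z') := by
  obtain ⟨κ, x, hκ, hx, hz⟩ := h
  obtain ⟨κ', x', hκ', hx', hz'⟩ := h'
  refine ⟨fun j => ⌊(c + c') * (j + 1)⌋₊, fun j => ∑ p ∈ Finset.HasAntidiagonal.antidiagonal j,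
      x p.1 * x' p.2,
    fun j => Nat.floor_le (by positivity), fun j => Submodule.sum_mem _ ?_, fun n => ?_⟩
  · rintro ⟨i, k⟩ hp
    have hik : i + k = j := Finset.HasAntidiagonal.mem_antidiagonal.1 hp
    have hle : κ i + κ' k ≤ ⌊(c + c') * ((j : ℝ) + 1)⌋₊ := by
      refine Nat.le_floor ?_
      have hi : (i : ℝ) ≤ j := by exact_mod_cast hik ▸ Nat.le_add_right i k
      have hk : (k : ℝ) ≤ j := by exact_mod_cast hik ▸ Nat.le_add_left k i
      have e1 := hκ i
      have e2 := hκ' k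
      push_cast
      nlinarith
    refine pow_le_pow_of_one_mem (Submodule.mem_sup_left h1) hle ?_
    rw [pow_add]
    have hl : M ^ κ i ≤ (M ⊔ M') ^ κ i := pow_le_pow_left' le_sup_left _
    have hr : M' ^ κ' k ≤ (M ⊔ M') ^ κ' k := pow_le_pow_left' le_sup_right _
    exact Submodule.mul_mem_mul (hl (hx i)) (hr (hx' k))
  · rw [map_mul, hz, hz', ← map_mul, Ideal.Quotient.eq]
    set I := Ideal.span {algebraMap V A ϖ}
    have e1 : (∑ j ∈ Finset.range n, ϖ ^ j • ∑ p ∈ Finset.HasAntidiagonal.antidiagonal j,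
      x p.1 * x' p.2) =
        ∑ p ∈ (Finset.range n ×ˢ Finset.range n) with p.1 + p.2 < n,
          (ϖ ^ p.1 • x p.1) * (ϖ ^ p.2 • x' p.2) := by
      have : ∀ j ∈ Finset.range n, (ϖ ^ j • ∑ p ∈ Finset.HasAntidiagonal.antidiagonal j,
      x p.1 * x' p.2) =
          ∑ p ∈ (Finset.range n ×ˢ Finset.range n) with p.1 + p.2 < n ∧ p.1 + p.2 = j,
            (ϖ ^ p.1 • x p.1) * (ϖ ^ p.2 • x' p.2) := by
        intro j hj
        rw [Finset.smul_sum]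
        refine Finset.sum_congr ?_ ?_
        · ext ⟨a, b⟩
          simp only [Finset.HasAntidiagonal.mem_antidiagonal, Finset.mem_filter, Finset.mem_product,
            Finset.mem_range] at hj ⊢
          omega
        · rintro ⟨a, b⟩ hab
          simp only [Finset.mem_filter] at hab
          rw [smul_mul_smul_comm, ← pow_add, hab.2.2]
      rw [Finset.sum_congr rfl this]
      simp only [← Finset.filter_filter]
      refine Finset.sum_fiberwise_of_maps_to (g := fun p : ℕ × ℕ => p.1 + p.2) ?_ _
      intro p hp
      simpa using (Finset.mem_filter.1 hp).2
    rw [e1, Finset.sum_mul_sum, ← Finset.sum_product',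
      ← Finset.sum_filter_add_sum_filter_not (Finset.range n ×ˢ Finset.range n)
        (fun p : ℕ × ℕ => p.1 + p.2 < n), add_sub_cancel_left]
    refine Ideal.sum_mem _ ?_
    rintro ⟨a, b⟩ hab
    have hn : n ≤ a + b := by simpa using (Finset.mem_filter.1 hab).2
    rw [smul_mul_smul_comm, ← pow_add, Algebra.smul_def, map_pow]
    have hI : algebraMap V A ϖ ^ (a + b) ∈ I ^ (a + b) :=
      Ideal.pow_mem_pow (Ideal.mem_span_singleton_self _) _
    exact Ideal.mul_mem_right _ (I ^ n) (Ideal.pow_le_pow_right hn hI)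

theorem isMWSum_of {M : Submodule V A} {a : A} (ha : a ∈ M) :
    IsMWSum ϖ M 1 (algebraMap A (AdicHat ϖ A) a) := by
  refine ⟨fun _ => 1, fun j => if j = 0 then a else 0, fun j => ?_, fun j => ?_, fun n => ?_⟩
  · push_cast
    linarith [(Nat.cast_nonneg j : (0 : ℝ) ≤ j)]
  · rw [pow_one]
    dsimp only
    split_ifs
    exacts [ha, Submodule.zero_mem _]
  · rcases n with _ | n
    · rw [Ideal.Quotient.eq.2 (?_ : (_ : A) - a ∈ _)]
      · rfl
      · simp
    · rw [Finset.sum_eq_single 0]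
      · simp
      · intro j _ hj
        simp [hj]
      · simp

variable (ϖ A)

/-- The Monsky–Washnitzer weak completion: all elements of the `ϖ`-adic completion of the form
`∑ⱼ ϖ ^ j w_j` with `w_j ∈ M ^ κ_j`, where `M` is a finitely generated `V`-submodule of `A` that
contains `1` and `κ_j ≤ c (j + 1)` for some constant `c > 0`. -/
noncomputable def dagger : Subalgebra V (AdicHat ϖ A) where
  carrier := {z | ∃ (M : Submodule V A) (c : ℝ), M.FG ∧ (1 : A) ∈ M ∧ 0 < c ∧ IsMWSum ϖ M c z}
  mul_mem' := by
    rintro z z' ⟨M, c, hM, h1, hc, h⟩ ⟨M', c', hM', h1', hc', h'⟩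
    exact ⟨M ⊔ M', c + c', hM.sup hM', Submodule.mem_sup_left h1, by positivity,
      h.mul h1 h1' hc hc' h'⟩
  add_mem' := by
    rintro z z' ⟨M, c, hM, h1, hc, h⟩ ⟨M', c', hM', h1', hc', h'⟩
    exact ⟨M ⊔ M', max c c', hM.sup hM', Submodule.mem_sup_left h1, lt_max_of_lt_left hc,
      (h.mono le_sup_left (le_max_left _ _)).add (Submodule.mem_sup_left h1)
        (h'.mono le_sup_right (le_max_right _ _))⟩
  algebraMap_mem' := by
    intro v
    refine ⟨Submodule.span V {1}, 1, Submodule.fg_span_singleton _,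
      Submodule.mem_span_singleton_self _, one_pos, ?_⟩
    exact isMWSum_of (ϖ := ϖ) (a := algebraMap V A v)
      (by rw [Algebra.algebraMap_eq_smul_one]
          exact Submodule.smul_mem _ _ (Submodule.mem_span_singleton_self _))

/-- The canonical homomorphism from `A` to its Monsky–Washnitzer completion. -/
noncomputable def toDagger : A →ₐ[V] dagger ϖ A where
  toFun a := ⟨algebraMap A (AdicHat ϖ A) a, Submodule.span V {1, a}, 1,
    Submodule.fg_span (by simp), Submodule.subset_span (by simp), one_pos,
    isMWSum_of (Submodule.subset_span (by simp))⟩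
  map_one' := Subtype.ext (map_one _)
  map_mul' a b := Subtype.ext (map_mul _ a b)
  map_zero' := Subtype.ext (map_zero _)
  map_add' a b := Subtype.ext (map_add _ a b)
  commutes' v := rfl

/-- The bornology on the Monsky–Washnitzer completion: a subset is bounded if all its elements are
of the form `∑ⱼ ϖ ^ j w_j` with `w_j ∈ M ^ κ_j` and `κ_j ≤ c (j + 1)` for the same finitely
generated `V`-submodule `M ∋ 1` and the same `c > 0`. -/
noncomputable def daggerBornology : ConvexBornology V (dagger ϖ A) :=
  ConvexBornology.ofBounded
    (fun S => ∃ (M : Submodule V A) (c : ℝ), M.FG ∧ (1 : A) ∈ M ∧ 0 < c ∧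
      ∀ z ∈ S, IsMWSum ϖ M c (z : AdicHat ϖ A))
    ⟨Submodule.span V {1}, 1, Submodule.fg_span_singleton _,
      Submodule.mem_span_singleton_self _, one_pos, fun _ h => h.elim⟩
    (fun _ ⟨M, c, hM, h1, hc, h⟩ _ hT => ⟨M, c, hM, h1, hc, fun z hz => h z (hT hz)⟩)
    (fun _ ⟨M, c, hM, h1, hc, h⟩ _ ⟨M', c', hM', _, _, h'⟩ =>
      ⟨M ⊔ M', max c c', hM.sup hM', Submodule.mem_sup_left h1, lt_max_of_lt_left hc,
        fun z hz => hz.elim (fun hz => (h z hz).mono le_sup_left (le_max_left _ _))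
          (fun hz => (h' z hz).mono le_sup_right (le_max_right _ _))⟩)
    (fun z => by
      obtain ⟨M, c, hM, h1, hc, h⟩ := z.2
      exact ⟨M, c, hM, h1, hc, fun y hy => by
        rw [Set.mem_singleton_iff] at hy
        rw [hy]
        exact h⟩)
    (fun S ⟨M, c, hM, h1, hc, h⟩ => ⟨M, c, hM, h1, hc, fun z hz => by
      induction hz using Submodule.span_induction with
      | mem z hz => exact h z hz
      | zero => exact IsMWSum.zero M hc.le
      | add x y _ _ hx hy => exact hx.add h1 hy
      | smul v x _ hx => exact hx.smul v⟩)

end Dagger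

/-! ### The comparison map -/

section Comparison

variable {V : Type*} [CommRing V] [IsDomain V] (K : Type*) [Field K] [Algebra V K]
  [IsFractionRing V K] {R : Type*} [CommRing R] [Algebra V R] {ϖ : V} (hϖ : Irreducible ϖ)
  {ε : ℝ} (hε0 : 0 < ε) (hε1 : ε < 1) (J : Ideal R) (α : ℝ)

/-- The Monsky–Washnitzer completion of the `α`-tube algebra. -/
abbrev TubeDagger : Type _ := dagger ϖ (tube K hϖ hε0 hε1 J α)

/-- The bornology on `K ⊗ TubeDagger`: tensor product of the fine bornology on `K` and of the
bornology of the Monsky–Washnitzer completion. -/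
noncomputable def tubeDaggerBornology :
    ConvexBornology V (K ⊗[V] TubeDagger K hϖ hε0 hε1 J α) :=
  (ConvexBornology.fine V K).tensor (daggerBornology ϖ (tube K hϖ hε0 hε1 J α))

/-- The homomorphism of `K`-algebras from `R_K` to `K ⊗ TubeDagger` induced by the canonical
homomorphisms from `R` to its tube algebra and from there to the Monsky–Washnitzer completion. -/
noncomputable def toTubeDagger :
    K ⊗[V] R →ₐ[K] K ⊗[V] TubeDagger K hϖ hε0 hε1 J α :=
  Algebra.TensorProduct.map (AlgHom.id K K)
    ((toDagger ϖ (tube K hϖ hε0 hε1 J α)).comp (toTube K hϖ hε0 hε1 J α))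

end Comparison

end BornTube

/-! Both bornologies come down to one growth condition. Choose finitely generated `V`-submodules `N
∋ 1` generating the algebra `R` and `M` generating the ideal `J`, let `q` be the denominator of `α`,
and put `G = ∑_{l ≤ q} ϖ^⌈-αl⌉ N M^l`. Since `αq` is an integer, `⌈-α(n+q)⌉ = ⌈-αn⌉ - αq`, so
factors `M^q` split off without loss and `G` generates the tube algebra `T`, which is therefore of
finite type. Say that `X ⊆ R_K` has linear growth if `ϖ^k X ⊆ ∑_j ϖ^j G^(c(j+1))` for some `k` and
`c`.

The subsets of linear growth are exactly the bounded subsets of the bornology attached to `J` and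
`α` (`alphaBornology_bounded_iff`). If `P ⊆ J` is finitely generated, then `P ⊆ N^h M`. For `r >
ε^α` and `s = log_ε r < α`, passing from `ϖ^⌈-αn⌉ P^n` to `r⁻ⁿ ⋆ P^n` gains about `(α - s)n` powers
of `ϖ`, which pay for the `(h+1)n + 1` factors `G` that are needed
(`exists_geomSum_le_linearGrowth`). Conversely, part of the factor `ϖ^j` in `ϖ^j G^(c(j+1))` turns
surplus factors `N` into factors `ϖ N^e`, which lie in `J` because `ϖ ∈ J`; the rest lowers `α` to
`α - δ`, that is, makes the radius larger than `ε^α` (`exists_linearGrowth_le_geomSum`).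

It remains to complete `R_K = K · T` for linear growth. A bounded map into a complete module is a
completion if it is dense and a bornological embedding (`isCompletion_of_dense_embedding`).
Completeness holds because the lattices in the Monsky–Washnitzer completion are closed under series
`∑ ϖ^i d_i`, regrouped along diagonals. Partial sums give density. The embedding says that an
element of `T` that has linear growth in the completion already has it in `T`; this is an Artin–Rees
statement, proved with the Noetherian Rees algebra of the filtration by powers of a generating
submodule (`exists_pow_inf_pow_smul_le`, `exists_mem_linearGrowth`). -/

namespace BornTube

/-! ### Criteria for completeness and for being a completion. -/

section Criteria

variable {V : Type*} [CommRing V]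
variable {M : Type*} [AddCommGroup M] [Module V M]
variable {N : Type*} [AddCommGroup N] [Module V N]

theorem ConvexBornology.Bounded.exists_submodule {B : ConvexBornology V M} {S : Set M}
    (h : B.Bounded S) : ∃ E : Submodule V M, B.Bounded (E : Set M) ∧ S ⊆ E :=
  ⟨Submodule.span V S, h.span, Submodule.subset_span⟩

theorem IsBoundedMap.submodule {B : ConvexBornology V M} {C : ConvexBornology V N} {f : M →ₗ[V] N}
    (hf : IsBoundedMap B C f) {E : Submodule V M} (hE : B.Bounded (E : Set M)) :
    C.Bounded (E.map f : Set N) := by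
  rw [Submodule.map_coe]
  exact hf _ hE

theorem smul_submodule_anti {ϖ : V} (E : Submodule V M) {m n : ℕ} (h : m ≤ n) :
    ϖ ^ n • E ≤ ϖ ^ m • E := by
  intro x hx
  obtain ⟨e, he, rfl⟩ := (Submodule.mem_smul_pointwise_iff_exists _ _ _).1 hx
  obtain ⟨k, rfl⟩ := Nat.exists_eq_add_of_le h
  rw [pow_add, mul_smul]
  exact Submodule.smul_mem_pointwise_smul _ _ _ (E.smul_mem _ he)

theorem smul_submodule_le {a : V} (E : Submodule V M) : a • E ≤ E := by
  intro x hx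
  obtain ⟨e, he, rfl⟩ := (Submodule.mem_smul_pointwise_iff_exists _ _ _).1 hx
  exact E.smul_mem _ he

theorem smul_set_subset_of_dvd {a b : V} (h : a ∣ b) {S : Set M} {E : Submodule V M}
    (hS : S ⊆ E) : b • S ⊆ (a • E : Submodule V M) := by
  rintro _ ⟨s, hs, rfl⟩
  obtain ⟨c, rfl⟩ := h
  dsimp only
  rw [mul_smul]
  exact Submodule.smul_mem_pointwise_smul _ _ _ (E.smul_mem _ (hS hs))

theorem SConverges.eventually {ϖ : V} {S : Set M} {x : ℕ → M} {y : M} (h : SConverges ϖ S x y)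
    {E : Submodule V M} (hS : S ⊆ E) (k : ℕ) :
    ∀ᶠ n in Filter.atTop, x n - y ∈ ϖ ^ k • E := by
  obtain ⟨δ, hδ, hx⟩ := h
  filter_upwards [hδ k] with n hn
  exact smul_set_subset_of_dvd hn hS (hx n)

theorem sConverges_of_eventually {ϖ : V} {E : Submodule V M} {x : ℕ → M} {y : M}
    (h : ∀ k, ∀ᶠ n in Filter.atTop, x n - y ∈ ϖ ^ k • E) (h0 : ∀ n, x n - y ∈ E) :
    SConverges ϖ (E : Set M) x y := by
  classical
  -- The search is cut off at `n`: the difference may lie in every `ϖ ^ k • E`, and then there is no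
  -- greatest exponent.
  refine ⟨fun n => ϖ ^ Nat.findGreatest (fun k => x n - y ∈ ϖ ^ k • E) n, fun k => ?_,
    fun n => ?_⟩
  · filter_upwards [h k, Filter.eventually_ge_atTop k] with n hn hkn
    exact pow_dvd_pow _ (Nat.le_findGreatest hkn hn)
  · rw [← Submodule.coe_pointwise_smul]
    exact Nat.findGreatest_spec (P := fun k => x n - y ∈ ϖ ^ k • E) (Nat.zero_le n)
      (by simpa using h0 n)

theorem sConverges_of_pow {ϖ : V} {E : Submodule V M} {x : ℕ → M} {y : M}
    (h : ∀ n, x n - y ∈ ϖ ^ n • E) : SConverges ϖ (E : Set M) x y :=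
  sConverges_of_eventually (fun k => by
    filter_upwards [Filter.eventually_ge_atTop k] with n hn
    exact smul_submodule_anti E hn (h n)) fun n => smul_submodule_le E (h n)

/-- A bornological module is complete if bounded submodules are Hausdorff and if bounded subsets are
contained in bounded submodules that contain the sums of all series `∑ ϖ ^ i d_i` of
their elements. -/
theorem isCompleteBorn_of_series {ϖ : V} {C : ConvexBornology V M}
    (hsep : ∀ E : Submodule V M, C.Bounded (E : Set M) → ∀ x, (∀ n : ℕ, x ∈ ϖ ^ n • E) → x = 0)
    (hser : ∀ S : Set M, C.Bounded S → ∃ E : Submodule V M, C.Bounded (E : Set M) ∧ S ⊆ E ∧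
      ∀ d : ℕ → M, (∀ i, d i ∈ E) →
        ∃ z, ∀ n, z - ∑ i ∈ Finset.range n, ϖ ^ i • d i ∈ ϖ ^ n • E) :
    IsCompleteBorn ϖ C := by
  refine ⟨fun x y z S T hS hT hy hz => ?_, fun S hS => ?_⟩
  · obtain ⟨E, hE, hSE⟩ := (hS.union hT).exists_submodule
    refine (sub_eq_zero.1 (hsep E hE (z - y) fun k => ?_)).symm
    obtain ⟨n, h1, h2⟩ := ((hy.eventually (Set.subset_union_left.trans hSE) k).and
      (hz.eventually (Set.subset_union_right.trans hSE) k)).exists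
    simpa using sub_mem h1 h2
  · obtain ⟨E, hE, hSE, hser⟩ := hser S hS
    refine ⟨E, hE, fun x ⟨δ, hδ, hx⟩ => ?_⟩
    -- Level `0` must start at index `0`, because `S'`-convergence constrains every term of the
    -- sequence and not just a tail.
    have key : ∀ k : ℕ, ∃ N : ℕ, (k = 0 → N = 0) ∧
        ∀ n m, N ≤ n → N ≤ m → x n - x m ∈ ϖ ^ k • E := by
      intro k
      rcases Nat.eq_zero_or_pos k with rfl | hk
      · exact ⟨0, fun _ => rfl, fun n m _ _ =>
          smul_set_subset_of_dvd (by simp) hSE (hx n m 0 (Nat.zero_le _) (Nat.zero_le _))⟩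
      · obtain ⟨N, hN⟩ := (hδ k).exists
        exact ⟨N, fun h => absurd h hk.ne', fun n m hn hm =>
          smul_set_subset_of_dvd hN hSE (hx n m N hn hm)⟩
    choose N₀ hN₀ hN using key
    -- Partial sums make the thresholds monotone, so that the differences along this subsequence are
    -- the terms of a series `∑ ϖ ^ k d_k`.
    let N : ℕ → ℕ := fun k => ∑ i ∈ Finset.range (k + 1), N₀ i
    have hN0 : N 0 = 0 := by simp [N, hN₀ 0 rfl]
    have hNN : ∀ k, N₀ k ≤ N k := fun k =>
      Finset.single_le_sum (f := N₀) (fun _ _ => Nat.zero_le _) (Finset.self_mem_range_succ k)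
    have hmono : ∀ k, N k ≤ N (k + 1) := fun k => by
      simp only [N]
      rw [Finset.sum_range_succ _ (k + 1)]
      exact Nat.le_add_right _ _
    have hd : ∀ k, ∃ d ∈ E, ϖ ^ k • d = x (N (k + 1)) - x (N k) := fun k =>
      (Submodule.mem_smul_pointwise_iff_exists _ _ _).1
        (hN k _ _ ((hNN k).trans (hmono k)) (hNN k))
    choose d hdE hd using hd
    obtain ⟨z, hz⟩ := hser d hdE
    have hy : ∀ k n, N k ≤ n → x n - (x 0 + z) ∈ ϖ ^ k • E := by
      intro k n hn
      have e : ∑ i ∈ Finset.range k, ϖ ^ i • d i = x (N k) - x 0 := by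
        rw [Finset.sum_congr rfl fun i _ => hd i, Finset.sum_range_sub (fun i => x (N i)), hN0]
      have h1 := hN k n (N k) ((hNN k).trans hn) (hNN k)
      have h2 := hz k
      rw [e] at h2
      have := sub_mem h1 h2
      convert this using 1
      abel
    refine ⟨x 0 + z, sConverges_of_eventually (fun k => ?_) fun n => ?_⟩
    · filter_upwards [Filter.eventually_ge_atTop (N k)] with n hn
      exact hy k n hn
    · exact smul_submodule_le E (hy 0 n (by simp [hN0]))

variable (ϖ : V) (C : ConvexBornology V N) (ι : M →ₗ[V] N)
  {Y : Type w} [AddCommGroup Y] [Module V Y] (D : ConvexBornology V Y) (f : M →ₗ[V] Y)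

/-- The points `x` and `y` are the limits of the images under `ι` and `f` of one sequence. -/
def CommonLimit (x : N) (y : Y) : Prop :=
  ∃ (u : ℕ → M) (Q : Submodule V N) (W : Submodule V Y), C.Bounded (Q : Set N) ∧
    D.Bounded (W : Set Y) ∧ ∀ n, ι (u n) - x ∈ ϖ ^ n • Q ∧ f (u n) - y ∈ ϖ ^ n • W

variable {ϖ C ι D f}

theorem CommonLimit.add {x x' : N} {y y' : Y} (h : CommonLimit ϖ C ι D f x y)
    (h' : CommonLimit ϖ C ι D f x' y') : CommonLimit ϖ C ι D f (x + x') (y + y') := by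
  obtain ⟨u, Q, W, hQ, hW, h⟩ := h
  obtain ⟨u', Q', W', hQ', hW', h'⟩ := h'
  refine ⟨u + u', Q ⊔ Q', W ⊔ W', hQ.sup hQ', hW.sup hW', fun n => ⟨?_, ?_⟩⟩
  · rw [Submodule.smul_sup', Pi.add_apply, map_add, add_sub_add_comm]
    exact Submodule.add_mem_sup (h n).1 (h' n).1
  · rw [Submodule.smul_sup', Pi.add_apply, map_add, add_sub_add_comm]
    exact Submodule.add_mem_sup (h n).2 (h' n).2

theorem CommonLimit.smul (v : V) {x : N} {y : Y} (h : CommonLimit ϖ C ι D f x y) :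
    CommonLimit ϖ C ι D f (v • x) (v • y) := by
  obtain ⟨u, Q, W, hQ, hW, h⟩ := h
  refine ⟨v • u, Q, W, hQ, hW, fun n => ⟨?_, ?_⟩⟩
  · rw [Pi.smul_apply, map_smul, ← smul_sub]
    exact Submodule.smul_mem _ _ (h n).1
  · rw [Pi.smul_apply, map_smul, ← smul_sub]
    exact Submodule.smul_mem _ _ (h n).2

theorem CommonLimit.of (m : M) : CommonLimit ϖ C ι D f (ι m) (f m) :=
  ⟨fun _ => m, Submodule.span V ∅, Submodule.span V ∅, C.bounded_empty.span, D.bounded_empty.span,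
    fun n => by simp⟩

theorem CommonLimit.apply (g : N →ₗ[V] Y) (hg : IsBoundedMap C D g) {x : N}
    (hx : ∃ (u : ℕ → M) (Q : Submodule V N), C.Bounded (Q : Set N) ∧
      ∀ n, ι (u n) - x ∈ ϖ ^ n • Q) : CommonLimit ϖ C ι D (g ∘ₗ ι) x (g x) := by
  obtain ⟨u, Q, hQ, hu⟩ := hx
  refine ⟨u, Q, Q.map g, hQ, hg.submodule hQ, fun n => ⟨hu n, ?_⟩⟩
  obtain ⟨q, hq, e⟩ := (Submodule.mem_smul_pointwise_iff_exists _ _ _).1 (hu n)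
  rw [LinearMap.comp_apply, ← map_sub, ← e, map_smul]
  exact Submodule.smul_mem_pointwise_smul _ _ _ (Submodule.mem_map_of_mem hq)

/-- A bounded linear map to a complete bornological module is a completion if it is a bornological
embedding with dense range. -/
theorem isCompletion_of_dense_embedding {B : ConvexBornology V M} (hC : IsCompleteBorn ϖ C)
    (hι : IsBoundedMap B C ι)
    (hemb : ∀ Q : Submodule V N, C.Bounded (Q : Set N) → ∃ P : Submodule V M,
      B.Bounded (P : Set M) ∧ ∀ (k : ℕ) (u : M), ι u ∈ ϖ ^ k • Q → u ∈ ϖ ^ k • P)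
    (hdense : ∀ S : Set N, C.Bounded S → ∃ Q : Submodule V N, C.Bounded (Q : Set N) ∧
      ∀ x ∈ S, ∀ n : ℕ, ∃ u, ι u - x ∈ ϖ ^ n • Q) :
    IsCompletion.{w} ϖ B C ι := by
  refine ⟨hC, hι, fun Y _ _ D hD f hf => ?_⟩
  -- Single-valuedness of the relation `CommonLimit`: the embedding property lifts `ι (u n) → 0` to
  -- `u n → 0`, hence `f (u n) → 0`, and limits in `Y` are unique.
  have hfun0 : ∀ y, CommonLimit ϖ C ι D f 0 y → y = 0 := by
    rintro y ⟨u, Q, W, hQ, hW, h⟩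
    obtain ⟨P, hP, hPQ⟩ := hemb Q hQ
    refine (hD.1 (f ∘ u) 0 y (P.map f) W (hf.submodule hP) hW (sConverges_of_pow fun n => ?_)
      (sConverges_of_pow fun n => (h n).2)).symm
    obtain ⟨p, hp, e⟩ := (Submodule.mem_smul_pointwise_iff_exists _ _ _).1
      (hPQ n (u n) (by simpa using (h n).1))
    rw [Function.comp_apply, ← e, sub_zero, map_smul]
    exact Submodule.smul_mem_pointwise_smul _ _ _ (Submodule.mem_map_of_mem hp)
  have hfun : ∀ x y y', CommonLimit ϖ C ι D f x y → CommonLimit ϖ C ι D f x y' → y = y' := by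
    intro x y y' h h'
    have := h.add (h'.smul (-1))
    simp only [neg_smul, one_smul, add_neg_cancel] at this
    exact eq_of_sub_eq_zero (by simpa [sub_eq_add_neg] using hfun0 _ this)
  -- Existence, with one `W` for all of `S`; this uniformity is what makes the extension bounded.
  have hex : ∀ S : Set N, C.Bounded S → ∃ W : Submodule V Y, D.Bounded (W : Set Y) ∧
      ∀ x ∈ S, ∃ y ∈ W, CommonLimit ϖ C ι D f x y := by
    intro S hS
    obtain ⟨Q, hQ, hSQ⟩ := hdense S hS
    obtain ⟨Q', hQ', hSQ'⟩ := (hS.union hQ).exists_submodule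
    obtain ⟨P, hP, hPQ⟩ := hemb Q' hQ'
    obtain ⟨S', hS', hlim⟩ := hD.2 _ (hf.submodule hP)
    obtain ⟨W, hW, hSW⟩ := ((hf.submodule hP).union hS').exists_submodule
    have hQQ' : Q ≤ Q' := Set.subset_union_right.trans hSQ'
    refine ⟨W, hW, fun x hx => ?_⟩
    choose u hu using hSQ x hx
    have hcau : SCauchy ϖ (P.map f : Set Y) (f ∘ u) := by
      refine ⟨fun n => ϖ ^ n, fun k => ?_, fun n m l hn hm => ?_⟩
      · filter_upwards [Filter.eventually_ge_atTop k] with n hn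
        exact pow_dvd_pow _ hn
      · have h1 : u n - u m ∈ ϖ ^ l • P := by
          refine hPQ l _ ?_
          have := sub_mem (smul_submodule_anti Q hn (hu n)) (smul_submodule_anti Q hm (hu m))
          rw [sub_sub_sub_cancel_right, ← map_sub] at this
          obtain ⟨q, hq, e⟩ := (Submodule.mem_smul_pointwise_iff_exists _ _ _).1 this
          rw [← e]
          exact Submodule.smul_mem_pointwise_smul _ _ _ (hQQ' hq)
        obtain ⟨p, hp, e⟩ := (Submodule.mem_smul_pointwise_iff_exists _ _ _).1 h1
        refine ⟨f p, Submodule.mem_map_of_mem hp, ?_⟩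
        simp [← map_smul, e]
    obtain ⟨y, hy⟩ := hlim _ hcau
    have hev := fun k => hy.eventually (Set.subset_union_right.trans hSW) k
    refine ⟨y, ?_, ?_⟩
    -- The limit lies in `W` since `f (u 0)` and `f (u 0) - y` do; the term of index `0` is
    -- controlled uniformly in `x ∈ S`.
    · have h0 : u 0 ∈ P := by
        have := hPQ 0 (u 0)
        simp only [pow_zero, one_smul] at this
        refine this ?_
        have h1 := hu 0
        simp only [pow_zero, one_smul] at h1
        simpa using Q'.add_mem (hQQ' h1) (hSQ' (Or.inl hx))
      obtain ⟨δ, -, hδ⟩ := hy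
      have h1 : (f ∘ u) 0 - y ∈ W := by
        obtain ⟨s, hs, e⟩ := hδ 0
        rw [← e]
        exact W.smul_mem _ (hSW (Or.inr hs))
      have h2 : f (u 0) ∈ W := hSW (Or.inl (Submodule.mem_map_of_mem h0))
      simpa using W.sub_mem h2 h1
    -- Convergence of `f ∘ u` has an unspecified rate; a subsequence restores the rate `ϖ ^ n`
    -- without spoiling the rate on the other side.
    · have hφ : ∀ k, ∃ n, k ≤ n ∧ (f ∘ u) n - y ∈ ϖ ^ k • W := fun k =>
        ((Filter.eventually_ge_atTop k).and (hev k)).exists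
      choose φ hφ hφy using hφ
      exact ⟨u ∘ φ, Q, W, hQ, hW, fun n => ⟨smul_submodule_anti Q (hφ n) (hu (φ n)), hφy n⟩⟩
  have hex1 : ∀ x, ∃ y, CommonLimit ϖ C ι D f x y := fun x => by
    obtain ⟨W, -, h⟩ := hex {x} (C.bounded_singleton x)
    obtain ⟨y, -, hy⟩ := h x rfl
    exact ⟨y, hy⟩
  choose g hg using hex1
  let G : N →ₗ[V] Y :=
    { toFun := g
      map_add' := fun x x' => hfun _ _ _ (hg _) ((hg x).add (hg x'))
      map_smul' := fun v x => hfun _ _ _ (hg _) ((hg x).smul v) }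
  refine ⟨G, ⟨fun S hS => ?_, LinearMap.ext fun m => hfun _ _ _ (hg _) (CommonLimit.of m)⟩, ?_⟩
  · obtain ⟨W, hW, h⟩ := hex S hS
    refine hW.subset ?_
    rintro _ ⟨x, hx, rfl⟩
    obtain ⟨y, hy, hxy⟩ := h x hx
    change g x ∈ W
    rwa [hfun _ _ _ (hg x) hxy]
  · rintro g' ⟨hg', rfl⟩
    refine LinearMap.ext fun x => hfun x _ _ (CommonLimit.apply g' hg' ?_) (hg x)
    obtain ⟨u, Q, _, hQ, _, h⟩ := hg x
    exact ⟨u, Q, hQ, fun n => (h n).1⟩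

end Criteria

/-! ### An Artin–Rees property for powers of a generating submodule. -/

section ArtinRees

open Polynomial

variable {V : Type*} [CommRing V] {A : Type*} [CommRing A] [Algebra V A]

theorem exists_le_pow_of_fg {F : Submodule V A} (h1 : (1 : A) ∈ F) (hgen : ∀ a, ∃ n, a ∈ F ^ n)
    {N : Submodule V A} (hN : N.FG) : ∃ n, N ≤ F ^ n := by
  choose d hd using hgen
  obtain ⟨s, rfl⟩ := hN
  refine ⟨s.sup d, Submodule.span_le.2 fun a ha => ?_⟩
  exact pow_le_pow_of_one_mem h1 (Finset.le_sup (f := d) ha) (hd a)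

/-- The Rees algebra of the filtration by the powers of the span of `s`. -/
noncomputable def reesOfSpan (V : Type*) [CommRing V] {A : Type*} [CommRing A] [Algebra V A]
    (s : Set A) : Subalgebra V A[X] :=
  Algebra.adjoin V (monomial 1 '' s)

theorem coeff_mem_of_mem_reesOfSpan {s : Set A} {p : A[X]} (hp : p ∈ reesOfSpan V s) (n : ℕ) :
    p.coeff n ∈ Submodule.span V s ^ n := by
  induction hp using Algebra.adjoin_induction generalizing n with
  | mem x hx =>
    obtain ⟨a, ha, rfl⟩ := hx
    rw [coeff_monomial]
    split_ifs with h
    · subst h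
      rw [pow_one]
      exact Submodule.subset_span ha
    · exact Submodule.zero_mem _
  | algebraMap r =>
    rw [Polynomial.algebraMap_apply, coeff_C]
    split_ifs with h
    · subst h
      rw [pow_zero]
      exact Submodule.algebraMap_mem r
    · exact Submodule.zero_mem _
  | add x y _ _ hx hy => exact Submodule.add_mem _ (hx n) (hy n)
  | mul x y _ _ hx hy =>
    rw [coeff_mul]
    refine Submodule.sum_mem _ fun p hp => ?_
    rw [← Finset.HasAntidiagonal.mem_antidiagonal.1 hp, pow_add]
    exact Submodule.mul_mem_mul (hx _) (hy _)

theorem monomial_mem_reesOfSpan {s : Set A} {n : ℕ} {a : A} (ha : a ∈ Submodule.span V s ^ n) :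
    monomial n a ∈ reesOfSpan V s := by
  have hle : Submodule.span V s ≤
      (Subalgebra.toSubmodule (reesOfSpan V s)).comap ((monomial 1).restrictScalars V) :=
    Submodule.span_le.2 fun a ha => Algebra.subset_adjoin ⟨a, ha, rfl⟩
  induction ha using Submodule.pow_induction_on_left' with
  | algebraMap r =>
    exact (reesOfSpan V s).algebraMap_mem r
  | add x y i hx hy h h' =>
    rw [map_add]
    exact add_mem h h'
  | mem_mul m hm i x hx h =>
    rw [Nat.succ_eq_add_one, add_comm, ← monomial_mul_monomial]
    exact mul_mem (hle hm) h

/-- An Artin–Rees property: an element of `F ^ n` that is divisible by `b` is the product of `b` and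
an element of `F ^ (n + D)`, for some constant `D`. -/
theorem exists_pow_inf_smul_le [IsNoetherianRing V] {F : Submodule V A} (hF : F.FG)
    (h1 : (1 : A) ∈ F) (hgen : ∀ a, ∃ n, a ∈ F ^ n) (b : V) :
    ∃ D : ℕ, ∀ n y, b • y ∈ F ^ n → ∃ z ∈ F ^ (n + D), b • y = b • z := by
  classical
  obtain ⟨s, rfl⟩ := hF
  set F := Submodule.span V (s : Set A) with hFdef
  have hfg : (reesOfSpan V (s : Set A)).FG :=
    ⟨s.image (monomial 1), by rw [Finset.coe_image]; rfl⟩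
  have : Algebra.FiniteType V (reesOfSpan V (s : Set A)) := (Subalgebra.fg_iff_finiteType _).1 hfg
  have : IsNoetherianRing (reesOfSpan V (s : Set A)) := Algebra.FiniteType.isNoetherianRing V _
  -- The ideal of elements of the Rees algebra that are divisible by `b` in `A[X]` is finitely
  -- generated. The quotients of the generators by `b` have finitely many coefficients in all, and
  -- these determine the shift `D`.
  obtain ⟨t, ht⟩ := IsNoetherian.noetherian
    ((Ideal.span {C (algebraMap V A b)}).comap (reesOfSpan V (s : Set A)).val)
  have hex : ∀ g : reesOfSpan V (s : Set A), ∃ D : ℕ, g ∈ t →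
      ∃ q : A[X], (g : A[X]) = b • q ∧ ∀ n, q.coeff n ∈ F ^ D := by
    intro g
    by_cases hg : g ∈ t
    · have : g ∈ (Ideal.span {C (algebraMap V A b)}).comap (reesOfSpan V (s : Set A)).val := by
        rw [← ht]
        exact Submodule.subset_span hg
      obtain ⟨q, hq⟩ := Ideal.mem_span_singleton'.1 (Ideal.mem_comap.1 this)
      obtain ⟨D, hD⟩ := exists_le_pow_of_fg h1 hgen
        (Submodule.fg_span (R := V) (q.support.finite_toSet.image q.coeff))
      refine ⟨D, fun _ => ⟨q, ?_, fun n => ?_⟩⟩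
      · rw [Algebra.smul_def, mul_comm]
        exact hq.symm
      · by_cases hn : n ∈ q.support
        · exact hD (Submodule.subset_span ⟨n, hn, rfl⟩)
        · rw [notMem_support_iff.1 hn]
          exact Submodule.zero_mem _
    · exact ⟨0, fun h => absurd h hg⟩
  choose d hd using hex
  refine ⟨t.sup d, fun n y hy => ?_⟩
  -- Multiplication by an element of the Rees algebra preserves the shift, since its coefficient of
  -- degree `i` lies in `F ^ i`.
  have key : ∀ g ∈ (Ideal.span {C (algebraMap V A b)}).comap (reesOfSpan V (s : Set A)).val,
      ∃ q : A[X], (g : A[X]) = b • q ∧ ∀ n, q.coeff n ∈ F ^ (n + t.sup d) := by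
    intro g hg
    rw [← ht] at hg
    induction hg using Submodule.span_induction with
    | mem g hg =>
      obtain ⟨q, hq, h⟩ := hd g hg
      exact ⟨q, hq, fun n => pow_le_pow_of_one_mem h1
        ((Finset.le_sup (f := d) hg).trans (Nat.le_add_left _ _)) (h n)⟩
    | zero => exact ⟨0, by simp, fun n => by simp⟩
    | add g g' _ _ h h' =>
      obtain ⟨q, hq, h⟩ := h
      obtain ⟨q', hq', h'⟩ := h'
      refine ⟨q + q', ?_, fun n => ?_⟩
      · rw [smul_add, ← hq, ← hq']
        rfl
      · rw [coeff_add]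
        exact add_mem (h n) (h' n)
    | smul r g _ h =>
      obtain ⟨q, hq, h⟩ := h
      refine ⟨r * q, ?_, fun n => ?_⟩
      · rw [← mul_smul_comm, ← hq]
        rfl
      · rw [coeff_mul]
        refine Submodule.sum_mem _ fun p hp => ?_
        rw [← Finset.HasAntidiagonal.mem_antidiagonal.1 hp, add_assoc, pow_add]
        exact Submodule.mul_mem_mul (coeff_mem_of_mem_reesOfSpan r.2 _) (h _)
  obtain ⟨q, hq, h⟩ := key ⟨monomial n (b • y), monomial_mem_reesOfSpan hy⟩ (by
    rw [Ideal.mem_comap, Ideal.mem_span_singleton']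
    refine ⟨monomial n y, ?_⟩
    rw [mul_comm, C_mul_monomial, ← Algebra.smul_def]
    rfl)
  refine ⟨q.coeff n, h n, ?_⟩
  rw [← coeff_smul, ← hq]
  simp

/-- Each division by `b` costs the same shift `D`, so the loss is linear in `k`. This linearity is
exactly what the growth condition tolerates. Absence of `b`-torsion identifies the quotient with the
element produced by Artin–Rees. -/
theorem exists_pow_inf_pow_smul_le [IsNoetherianRing V] {F : Submodule V A} (hF : F.FG)
    (h1 : (1 : A) ∈ F) (hgen : ∀ a, ∃ n, a ∈ F ^ n) {b : V} (hb : ∀ a : A, b • a = 0 → a = 0) :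
    ∃ D : ℕ, ∀ k n y, b ^ k • y ∈ F ^ n → y ∈ F ^ (n + k * D) := by
  obtain ⟨D, hD⟩ := exists_pow_inf_smul_le hF h1 hgen b
  refine ⟨D, fun k => ?_⟩
  induction k with
  | zero => simp
  | succ k ih =>
    intro n y hy
    rw [pow_succ', mul_smul] at hy
    obtain ⟨z, hz, e⟩ := hD n _ hy
    have : b ^ k • y = z := eq_of_sub_eq_zero (hb _ (by rw [smul_sub, e, sub_self]))
    have := ih (n + D) y (this ▸ hz)
    rwa [add_assoc, add_comm D, ← Nat.succ_mul] at this

end ArtinRees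

/-! ### Series in the `ϖ`-adic completion. -/

section Series

variable {V : Type*} [CommRing V] {ϖ : V} {A : Type*} [CommRing A] [Algebra V A]

theorem mem_span_algebraMap_pow {n : ℕ} {a : A} :
    a ∈ Ideal.span {algebraMap V A ϖ} ^ n ↔ ∃ b : A, a = ϖ ^ n • b := by
  rw [Ideal.span_singleton_pow, Ideal.mem_span_singleton']
  simp only [Algebra.smul_def, map_pow, mul_comm, eq_comm]

theorem mk_sum_range_of_le (x : ℕ → A) {m n : ℕ} (h : m ≤ n) :
    Ideal.Quotient.mk (Ideal.span {algebraMap V A ϖ} ^ m)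
      (∑ j ∈ Finset.range n, ϖ ^ j • x j) =
    Ideal.Quotient.mk (Ideal.span {algebraMap V A ϖ} ^ m)
      (∑ j ∈ Finset.range m, ϖ ^ j • x j) := by
  rw [Ideal.Quotient.eq, ← Finset.sum_range_add_sum_Ico _ h, add_sub_cancel_left]
  refine Ideal.sum_mem _ fun j hj => mem_span_algebraMap_pow.2 ⟨ϖ ^ (j - m) • x j, ?_⟩
  rw [← mul_smul, ← pow_add, Nat.add_sub_cancel' (Finset.mem_Ico.1 hj).1]

variable (ϖ) in
/-- The sum `∑ⱼ ϖ ^ j x_j` in the `ϖ`-adic completion. -/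
noncomputable def mwSum (x : ℕ → A) : AdicHat ϖ A :=
  AdicCompletion.mk _ A (AdicCompletion.AdicCauchySequence.mk _ A
    (fun n => ∑ j ∈ Finset.range n, ϖ ^ j • x j) fun n => by
      rw [SModEq.sub_mem, smul_eq_mul, Ideal.mul_top, ← Ideal.Quotient.eq]
      exact (mk_sum_range_of_le x n.le_succ).symm)

theorem evalₐ_mwSum (x : ℕ → A) (n : ℕ) :
    AdicCompletion.evalₐ (Ideal.span {algebraMap V A ϖ}) n (mwSum ϖ x) =
      Ideal.Quotient.mk _ (∑ j ∈ Finset.range n, ϖ ^ j • x j) :=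
  AdicCompletion.evalₐ_mk _ _ _

theorem evalₐ_of_algebraMap (a : A) (n : ℕ) :
    AdicCompletion.evalₐ (Ideal.span {algebraMap V A ϖ}) n (algebraMap A (AdicHat ϖ A) a) =
      Ideal.Quotient.mk _ a :=
  AlgHom.commutes _ a

theorem evalₐ_smul (v : V) (z : AdicHat ϖ A) (n : ℕ) :
    AdicCompletion.evalₐ (Ideal.span {algebraMap V A ϖ}) n (v • z) =
      Ideal.Quotient.mk _ (algebraMap V A v) * AdicCompletion.evalₐ _ n z := by
  rw [Algebra.smul_def, map_mul, evalₐ_algebraMap]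

theorem isMWSum_iff {F : Submodule V A} (h1 : (1 : A) ∈ F) {c : ℕ} {z : AdicHat ϖ A} :
    IsMWSum ϖ F c z ↔ ∃ x : ℕ → A, (∀ j, x j ∈ F ^ (c * (j + 1))) ∧ z = mwSum ϖ x := by
  constructor
  · rintro ⟨κ, x, hκ, hx, hz⟩
    refine ⟨x, fun j => pow_le_pow_of_one_mem h1 (by exact_mod_cast hκ j) (hx j),
      AdicCompletion.ext_evalₐ fun n => ?_⟩
    rw [hz, evalₐ_mwSum]
  · rintro ⟨x, hx, rfl⟩
    exact ⟨fun j => c * (j + 1), x, fun j => by push_cast; rfl, hx, evalₐ_mwSum x⟩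

theorem mwSum_add (x y : ℕ → A) : mwSum ϖ (x + y) = mwSum ϖ x + mwSum ϖ y := by
  refine AdicCompletion.ext_evalₐ fun n => ?_
  rw [map_add, evalₐ_mwSum, evalₐ_mwSum, evalₐ_mwSum, ← map_add, ← Finset.sum_add_distrib]
  simp only [Pi.add_apply, smul_add]

theorem mwSum_eq_add_shift (x : ℕ → A) (n : ℕ) :
    mwSum ϖ x = algebraMap A (AdicHat ϖ A) (∑ j ∈ Finset.range n, ϖ ^ j • x j) +
      ϖ ^ n • mwSum ϖ fun j => x (n + j) := by
  refine AdicCompletion.ext_evalₐ fun m => ?_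
  rw [map_add, evalₐ_smul, evalₐ_mwSum, evalₐ_mwSum, evalₐ_of_algebraMap, ← map_mul, ← map_add,
    ← Algebra.smul_def, Finset.smul_sum, ← mk_sum_range_of_le x (Nat.le_add_left m n),
    Finset.sum_range_add]
  simp only [← mul_smul, ← pow_add]

theorem pow_smul_mwSum (x : ℕ → A) (n : ℕ) :
    ϖ ^ n • mwSum ϖ x = mwSum ϖ fun j => if j < n then 0 else x (j - n) := by
  rw [mwSum_eq_add_shift (fun j => if j < n then 0 else x (j - n)) n,
    Finset.sum_eq_zero, map_zero, zero_add]
  · simp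
  · intro j hj
    simp [Finset.mem_range.1 hj]

theorem algebraMap_pow_smul_eq_mwSum (a : A) (n : ℕ) :
    algebraMap A (AdicHat ϖ A) (ϖ ^ n • a) = mwSum ϖ fun j => if j = n then a else 0 := by
  refine AdicCompletion.ext_evalₐ fun m => ?_
  rw [evalₐ_mwSum, evalₐ_of_algebraMap]
  by_cases h : n < m
  · simp [h]
  · simp only [smul_ite, smul_zero, Finset.sum_ite_eq', Finset.mem_range, h, if_false, map_zero]
    rw [Ideal.Quotient.eq_zero_iff_mem, mem_span_algebraMap_pow]
    exact ⟨ϖ ^ (n - m) • a, by rw [← mul_smul, ← pow_add, Nat.add_sub_cancel' (not_lt.1 h)]⟩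

/-- The coefficients of the double series `∑ᵢⱼ ϖ ^ (i + j) w_ij`. -/
def diagSum (w : ℕ → ℕ → A) (l : ℕ) : A :=
  ∑ p ∈ Finset.HasAntidiagonal.antidiagonal l, w p.1 p.2

theorem mwSum_diagSum_succ (w : ℕ → ℕ → A) :
    mwSum ϖ (diagSum w) = mwSum ϖ (w 0) + ϖ • mwSum ϖ (diagSum fun i => w (i + 1)) := by
  have h := pow_smul_mwSum (ϖ := ϖ) (diagSum fun i => w (i + 1)) 1
  rw [pow_one] at h
  rw [h, ← mwSum_add]
  congr 1
  funext l
  rcases l with _ | l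
  · simp [diagSum]
  · simp [diagSum, Finset.Nat.sum_antidiagonal_succ]

/-- The remainder after `n` rows is `ϖ ^ n` times a diagonal sum of the same kind, so it obeys the
same growth bound as the whole. -/
theorem mwSum_diagSum (w : ℕ → ℕ → A) (n : ℕ) :
    mwSum ϖ (diagSum w) = ∑ i ∈ Finset.range n, ϖ ^ i • mwSum ϖ (w i) +
      ϖ ^ n • mwSum ϖ (diagSum fun i => w (i + n)) := by
  induction n with
  | zero => simp
  | succ n ih =>
    rw [ih, mwSum_diagSum_succ, Finset.sum_range_succ, smul_add, ← mul_smul, ← pow_succ, zero_add,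
      add_assoc]
    simp only [add_assoc, add_comm 1 n]

/-- The constant `c` does not increase, because the bound on `w i j` is uniform in `i` and `j ≤ l`
on the diagonal. -/
theorem diagSum_mem {F : Submodule V A} (h1 : (1 : A) ∈ F) {c : ℕ} {w : ℕ → ℕ → A}
    (hw : ∀ i j, w i j ∈ F ^ (c * (j + 1))) (l : ℕ) : diagSum w l ∈ F ^ (c * (l + 1)) := by
  refine Submodule.sum_mem _ fun p hp => ?_
  have := Finset.HasAntidiagonal.mem_antidiagonal.1 hp
  exact pow_le_pow_of_one_mem h1 (Nat.mul_le_mul_left _ (by omega)) (hw _ _)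

theorem eq_zero_of_forall_eq_pow_smul {z : AdicHat ϖ A} (h : ∀ n : ℕ, ∃ e, z = ϖ ^ n • e) :
    z = 0 := by
  refine AdicCompletion.ext_evalₐ fun n => ?_
  obtain ⟨e, rfl⟩ := h n
  rw [evalₐ_smul, map_zero, Ideal.Quotient.eq_zero_iff_mem.2, zero_mul]
  exact mem_span_algebraMap_pow.2 ⟨1, by rw [← Algebra.algebraMap_eq_smul_one]⟩

theorem exists_eq_pow_smul_of_algebraMap_eq {a : A} {n : ℕ} {z : AdicHat ϖ A}
    (h : algebraMap A (AdicHat ϖ A) a = ϖ ^ n • z) : ∃ b : A, a = ϖ ^ n • b := by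
  have h' := congrArg (AdicCompletion.evalₐ (Ideal.span {algebraMap V A ϖ}) n) h
  rw [evalₐ_smul, evalₐ_of_algebraMap, Ideal.Quotient.eq_zero_iff_mem.2
    (mem_span_algebraMap_pow.2 ⟨1, Algebra.algebraMap_eq_smul_one _⟩), zero_mul] at h'
  exact mem_span_algebraMap_pow.1 (Ideal.Quotient.eq_zero_iff_mem.1 h')

/-- Read modulo `ϖ ^ (n + 1)`, the relation says that `ϖ` times a representative is divisible by `ϖ
^ (n + 1)`; cancelling one `ϖ` in `A` shows that the representative vanishes modulo `ϖ ^ n`. -/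
theorem adicHat_smul_eq_zero (htf : ∀ a : A, ϖ • a = 0 → a = 0) {z : AdicHat ϖ A}
    (h : ϖ • z = 0) : z = 0 := by
  induction z using AdicCompletion.induction_on with
  | h f =>
    refine AdicCompletion.ext_evalₐ fun n => ?_
    have h' := congrArg (AdicCompletion.evalₐ (Ideal.span {algebraMap V A ϖ}) (n + 1)) h
    rw [evalₐ_smul, map_zero, AdicCompletion.evalₐ_mk, ← map_mul, ← Algebra.smul_def,
      Ideal.Quotient.eq_zero_iff_mem, mem_span_algebraMap_pow] at h'
    obtain ⟨b, hb⟩ := h'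
    rw [pow_succ', mul_smul] at hb
    have hb' : f.1 (n + 1) = ϖ ^ n • b :=
      eq_of_sub_eq_zero (htf _ (by rw [smul_sub, hb, sub_self]))
    rw [AdicCompletion.evalₐ_mk, map_zero, ← AdicCompletion.Ideal.mk_eq_mk _ n.le_succ]
    exact Ideal.Quotient.eq_zero_iff_mem.2 (mem_span_algebraMap_pow.2 ⟨b, hb'⟩)

end Series

/-! ### Lattices in the Monsky–Washnitzer completion and linear growth. -/

section MWSubmodule

variable {V : Type*} [CommRing V] (ϖ : V) {A : Type*} [CommRing A] [Algebra V A]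

/-- The elements of the Monsky–Washnitzer completion of the form `∑ⱼ ϖ ^ j w_j` with
`w_j ∈ F ^ (c (j + 1))`. -/
noncomputable def mwSubmodule {F : Submodule V A} (h1 : (1 : A) ∈ F) (c : ℕ) :
    Submodule V (dagger ϖ A) where
  carrier := {z | IsMWSum ϖ F c (z : AdicHat ϖ A)}
  add_mem' h h' := IsMWSum.add h1 h h'
  zero_mem' := IsMWSum.zero F c.cast_nonneg
  smul_mem' v _ h := IsMWSum.smul v h

/-- The submodule `∑ⱼ ϖ ^ j F ^ (c (j + 1))`. -/
noncomputable def linearGrowth (F : Submodule V A) (c : ℕ) : Submodule V A :=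
  ⨆ j : ℕ, ϖ ^ j • F ^ (c * (j + 1))

variable {ϖ}

theorem mem_mwSubmodule {F : Submodule V A} {h1 : (1 : A) ∈ F} {c : ℕ} {z : dagger ϖ A} :
    z ∈ mwSubmodule ϖ h1 c ↔ IsMWSum ϖ F c (z : AdicHat ϖ A) :=
  Iff.rfl

theorem mwSubmodule_mono {F : Submodule V A} (h1 : (1 : A) ∈ F) {c c' : ℕ} (h : c ≤ c') :
    mwSubmodule ϖ h1 c ≤ mwSubmodule ϖ h1 c' :=
  fun _ hz => IsMWSum.mono hz le_rfl (by exact_mod_cast h)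

theorem linearGrowth_mono {F : Submodule V A} (h1 : (1 : A) ∈ F) {c c' : ℕ} (h : c ≤ c') :
    linearGrowth ϖ F c ≤ linearGrowth ϖ F c' :=
  iSup_mono fun _ => Submodule.map_mono (pow_le_pow_of_one_mem h1 (Nat.mul_le_mul_right _ h))

theorem mem_linearGrowth {F : Submodule V A} {c j : ℕ} {a : A} (ha : a ∈ F ^ (c * (j + 1))) :
    ϖ ^ j • a ∈ linearGrowth ϖ F c :=
  Submodule.mem_iSup_of_mem j (Submodule.smul_mem_pointwise_smul _ _ _ ha)

/-- Any finitely generated `M` lies in some `F ^ D`, so a single generating `F` suffices, at the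
cost of replacing `c` by `D * ⌈c⌉₊`. -/
theorem daggerBornology_bounded_iff {F : Submodule V A} (hF : F.FG) (h1 : (1 : A) ∈ F)
    (hgen : ∀ a, ∃ n, a ∈ F ^ n) {S : Set (dagger ϖ A)} :
    (daggerBornology ϖ A).Bounded S ↔ ∃ c : ℕ, S ⊆ mwSubmodule ϖ h1 c := by
  rw [daggerBornology, ConvexBornology.bounded_ofBounded_iff]
  constructor
  · rintro ⟨M, c, hM, -, -, h⟩
    obtain ⟨D, hD⟩ := exists_le_pow_of_fg h1 hgen hM
    refine ⟨D * ⌈c⌉₊, fun z hz => ?_⟩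
    obtain ⟨κ, x, hκ, hx, hz⟩ := h z hz
    refine ⟨fun j => D * κ j, x, fun j => ?_, fun j => ?_, hz⟩
    · push_cast
      rw [mul_assoc]
      gcongr
      exact (hκ j).trans (by gcongr; exact Nat.le_ceil c)
    · rw [pow_mul]
      exact pow_le_pow_left' hD _ (hx j)
  · rintro ⟨c, h⟩
    exact ⟨F, (c + 1 : ℕ), hF, h1, by positivity,
      fun z hz => mwSubmodule_mono h1 c.le_succ (h hz)⟩

theorem mul_mem_mwSubmodule {F : Submodule V A} (h1 : (1 : A) ∈ F) {c c' : ℕ} {z z' : dagger ϖ A}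
    (h : z ∈ mwSubmodule ϖ h1 c) (h' : z' ∈ mwSubmodule ϖ h1 c') :
    z * z' ∈ mwSubmodule ϖ h1 (c + 1 + (c' + 1)) := by
  have := IsMWSum.mul h1 h1 (c := (c + 1 : ℕ)) (c' := (c' + 1 : ℕ)) (by positivity) (by positivity)
    (mwSubmodule_mono h1 c.le_succ h) (mwSubmodule_mono h1 c'.le_succ h')
  rw [sup_idem] at this
  rw [mem_mwSubmodule]
  exact_mod_cast this

/-- Sum and remainders stay in the lattice with the same `c`, as `isCompleteBorn_of_series` demands.
-/
theorem exists_series_mwSubmodule {F : Submodule V A} (h1 : (1 : A) ∈ F) (hF : F.FG) {c : ℕ}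
    {d : ℕ → dagger ϖ A} (hd : ∀ i, d i ∈ mwSubmodule ϖ h1 c) :
    ∃ z : dagger ϖ A, ∀ n, ∃ e ∈ mwSubmodule ϖ h1 c,
      z - ∑ i ∈ Finset.range n, ϖ ^ i • d i = ϖ ^ n • e := by
  choose w hw hdw using fun i => (isMWSum_iff h1).1 (hd i)
  have hmem : ∀ n, IsMWSum ϖ F (c : ℝ) (mwSum ϖ (diagSum fun i => w (i + n))) := fun n =>
    (isMWSum_iff h1).2 ⟨_, diagSum_mem h1 fun i j => hw (i + n) j, rfl⟩
  let e : ℕ → dagger ϖ A := fun n => ⟨_, F, (c + 1 : ℕ), hF, h1, by positivity,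
    (hmem n).mono le_rfl (by push_cast; linarith)⟩
  refine ⟨e 0, fun n => ⟨e n, hmem n, Subtype.ext ?_⟩⟩
  rw [AddSubgroupClass.coe_sub, AddSubmonoidClass.coe_finsetSum]
  simp only [SetLike.val_smul, hdw]
  change mwSum ϖ (diagSum w) - _ = _
  rw [mwSum_diagSum w n, add_sub_cancel_left]

/-- Cutting at `2n` rather than `n` leaves a spare factor `ϖ ^ n`. It moves `w (n + j)` to position
`j ≥ n`, where `n + j + 1 ≤ 2(j + 1)`, so the error has growth constant `2 * c` for every `n`. -/
theorem exists_partialSum_mwSubmodule {F : Submodule V A} (h1 : (1 : A) ∈ F) (hF : F.FG) {c : ℕ}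
    {z : dagger ϖ A} (hz : z ∈ mwSubmodule ϖ h1 c) (n : ℕ) :
    ∃ a : A, ∃ e ∈ mwSubmodule ϖ h1 (2 * c), toDagger ϖ A a - z = ϖ ^ n • e := by
  obtain ⟨w, hw, hz⟩ := (isMWSum_iff h1).1 hz
  have hmem : IsMWSum ϖ F (2 * c : ℕ) (ϖ ^ n • mwSum ϖ fun j => w (n + n + j)) := by
    rw [pow_smul_mwSum]
    refine (isMWSum_iff h1).2 ⟨_, fun j => ?_, rfl⟩
    split_ifs with h
    · exact Submodule.zero_mem _
    · refine pow_le_pow_of_one_mem h1 ?_ (hw _)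
      rw [mul_comm 2 c, mul_assoc]
      exact Nat.mul_le_mul_left _ (by omega)
  let e : dagger ϖ A := ⟨_, F, (2 * c + 1 : ℕ), hF, h1, by positivity,
    hmem.mono le_rfl (by push_cast; linarith)⟩
  refine ⟨∑ j ∈ Finset.range (n + n), ϖ ^ j • w j, -e, neg_mem (S := Submodule V (dagger ϖ A)) hmem,
    Subtype.ext ?_⟩
  rw [AddSubgroupClass.coe_sub, SetLike.val_smul, NegMemClass.coe_neg, smul_neg, hz]
  change algebraMap A (AdicHat ϖ A) _ - _ = -(ϖ ^ n • ϖ ^ n • mwSum ϖ fun j => w (n + n + j))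
  rw [mwSum_eq_add_shift w (n + n), ← mul_smul, ← pow_add]
  abel

theorem toDagger_mem_mwSubmodule {F : Submodule V A} (h1 : (1 : A) ∈ F) {c : ℕ} {a : A}
    (ha : a ∈ linearGrowth ϖ F c) : toDagger ϖ A a ∈ mwSubmodule ϖ h1 c := by
  suffices linearGrowth ϖ F c ≤ (mwSubmodule ϖ h1 c).comap (toDagger ϖ A).toLinearMap from this ha
  refine iSup_le fun j x hx => ?_
  obtain ⟨b, hb, rfl⟩ := (Submodule.mem_smul_pointwise_iff_exists _ _ _).1 hx
  refine (isMWSum_iff h1).2 ⟨_, fun i => ?_, algebraMap_pow_smul_eq_mwSum b j⟩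
  split_ifs with h
  · exact h ▸ hb
  · exact Submodule.zero_mem _

/-- This is the embedding property. If `a ∈ F ^ h`, the series for `a` is cut at `h`: the remainder
is `ϖ ^ h • b` with `b ∈ A`, and it lies in `F ^ ((c + 1) * h)`. By Artin–Rees, `b` lies in a power
of `F` that is linear in `h`, so `ϖ ^ h • b` has linear growth although `h` depends on `a`. -/
theorem exists_mem_linearGrowth [IsNoetherianRing V] {F : Submodule V A} (hF : F.FG)
    (h1 : (1 : A) ∈ F) (hgen : ∀ a, ∃ n, a ∈ F ^ n) (htf : ∀ a : A, ϖ • a = 0 → a = 0) (c : ℕ) :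
    ∃ c' : ℕ, ∀ a, toDagger ϖ A a ∈ mwSubmodule ϖ h1 c → a ∈ linearGrowth ϖ F c' := by
  obtain ⟨D, hD⟩ := exists_pow_inf_pow_smul_le hF h1 hgen htf
  refine ⟨c + 1 + D, fun a ha => ?_⟩
  obtain ⟨h, hh⟩ := hgen a
  obtain ⟨x, hx, e⟩ := (isMWSum_iff h1).1 ha
  change algebraMap A (AdicHat ϖ A) a = _ at e
  rw [mwSum_eq_add_shift x h, ← sub_eq_iff_eq_add', ← map_sub] at e
  obtain ⟨b, hb⟩ := exists_eq_pow_smul_of_algebraMap_eq e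
  rw [sub_eq_iff_eq_add'] at hb
  have hxF : ∀ j ∈ Finset.range h, ϖ ^ j • x j ∈ F ^ ((c + 1) * h) := fun j hj =>
    Submodule.smul_mem _ _ (pow_le_pow_of_one_mem h1
      (Nat.mul_le_mul c.le_succ (Finset.mem_range.1 hj)) (hx j))
  have hbF : b ∈ F ^ ((c + 1) * h + h * D) := hD h _ b (by
    rw [← sub_eq_iff_eq_add'.2 hb]
    refine sub_mem (pow_le_pow_of_one_mem h1 ?_ hh) (sum_mem hxF)
    exact Nat.le_mul_of_pos_left _ c.succ_pos)
  rw [hb]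
  refine add_mem (sum_mem fun j hj => mem_linearGrowth ?_) (mem_linearGrowth ?_)
  · exact pow_le_pow_of_one_mem h1 (Nat.mul_le_mul_right _ (by omega)) (hx j)
  · refine pow_le_pow_of_one_mem h1 ?_ hbF
    nlinarith

theorem dagger_smul_eq_zero (htf : ∀ a : A, ϖ • a = 0 → a = 0) {z : dagger ϖ A}
    (h : ϖ • z = 0) : z = 0 :=
  Subtype.ext (adicHat_smul_eq_zero htf (congrArg Subtype.val h))

end MWSubmodule

/-! ### The fraction field and torsion-free modules. -/

section FractionField

theorem algebraMap_uniformizer_ne_zero {V : Type*} [CommRing V] [IsDomain V] (K : Type*) [Field K]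
    [Algebra V K] [IsFractionRing V K] {ϖ : V} (hϖ : Irreducible ϖ) : algebraMap V K ϖ ≠ 0 := by
  simpa using hϖ.ne_zero

theorem inv_pow_eq_mul_of_le {V : Type*} [CommRing V] [IsDomain V] (K : Type*) [Field K]
    [Algebra V K] [IsFractionRing V K] {ϖ : V} (hϖ : Irreducible ϖ) {k l : ℕ} (h : k ≤ l) :
    (algebraMap V K ϖ)⁻¹ ^ k = (algebraMap V K ϖ)⁻¹ ^ l * algebraMap V K (ϖ ^ (l - k)) := by
  have := algebraMap_uniformizer_ne_zero K hϖ
  obtain ⟨m, rfl⟩ := Nat.exists_eq_add_of_le h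
  rw [Nat.add_sub_cancel_left, map_pow, pow_add, mul_assoc, ← mul_pow, inv_mul_cancel₀ this,
    one_pow, mul_one]

variable {V : Type*} [CommRing V] [IsDomain V] [IsDiscreteValuationRing V]
  (K : Type*) [Field K] [Algebra V K] [IsFractionRing V K] {ϖ : V}


theorem exists_eq_inv_pow_mul (hϖ : Irreducible ϖ) (x : K) :
    ∃ (k : ℕ) (v : V), x = (algebraMap V K ϖ)⁻¹ ^ k * algebraMap V K v := by
  obtain ⟨a, b, hb, rfl⟩ := IsFractionRing.div_surjective (A := V) x
  obtain ⟨k, u, rfl⟩ := IsDiscreteValuationRing.eq_unit_mul_pow_irreducible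
    (nonZeroDivisors.ne_zero hb) hϖ
  refine ⟨k, a * ↑u⁻¹, ?_⟩
  have hu : algebraMap V K u ≠ 0 := by simp
  have hu' : algebraMap V K (↑u⁻¹ : V) = (algebraMap V K u)⁻¹ := by
    refine eq_inv_of_mul_eq_one_left ?_
    rw [← map_mul, Units.inv_mul, map_one]
  have := algebraMap_uniformizer_ne_zero K hϖ
  rw [map_mul, map_mul, map_pow, hu', inv_pow]
  field_simp

theorem exists_forall_eq_inv_pow_mul (hϖ : Irreducible ϖ) {P : Submodule V K} (hP : P.FG) :
    ∃ k : ℕ, ∀ x ∈ P, ∃ v : V, x = (algebraMap V K ϖ)⁻¹ ^ k * algebraMap V K v := by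
  choose d v hv using exists_eq_inv_pow_mul K hϖ
  obtain ⟨s, rfl⟩ := hP
  refine ⟨s.sup d, fun x hx => ?_⟩
  induction hx using Submodule.span_induction with
  | mem x hx =>
    refine ⟨ϖ ^ (s.sup d - d x) * v x, ?_⟩
    rw [map_mul, ← mul_assoc, ← inv_pow_eq_mul_of_le K hϖ (Finset.le_sup hx)]
    exact hv x
  | zero => exact ⟨0, by simp⟩
  | add x y _ _ h h' =>
    obtain ⟨a, ha⟩ := h
    obtain ⟨b, hb⟩ := h'
    exact ⟨a + b, by rw [map_add, mul_add, ← ha, ← hb]⟩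
  | smul r x _ h =>
    obtain ⟨a, ha⟩ := h
    refine ⟨r * a, ?_⟩
    rw [Algebra.smul_def, map_mul, ha]
    ring

/-- `K ⊗ N` is the localization of `N` at the nonzero elements of `V`, all of which are units times
powers of `ϖ`. -/
theorem one_tmul_injective (hϖ : Irreducible ϖ) {N : Type*} [AddCommGroup N] [Module V N]
    (htf : ∀ z : N, ϖ • z = 0 → z = 0) {z z' : N} (h : (1 : K) ⊗ₜ[V] z = 1 ⊗ₜ z') : z = z' := by
  have hloc : IsLocalizedModule (nonZeroDivisors V) (TensorProduct.mk V K N 1) :=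
    (isLocalizedModule_iff_isBaseChange (nonZeroDivisors V) K _).2 (TensorProduct.isBaseChange V N K)
  have h0 : TensorProduct.mk V K N 1 (z - z') = 0 := by
    rw [map_sub, sub_eq_zero]
    exact h
  obtain ⟨⟨b, hb⟩, hc⟩ := (IsLocalizedModule.eq_zero_iff (nonZeroDivisors V) _).1 h0
  obtain ⟨k, u, rfl⟩ := IsDiscreteValuationRing.eq_unit_mul_pow_irreducible
    (nonZeroDivisors.ne_zero hb) hϖ
  have hc' : ϖ ^ k • (z - z') = 0 := by
    rw [Submonoid.mk_smul, mul_smul] at hc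
    exact (smul_eq_zero_iff_eq u).1 hc
  have : ∀ k : ℕ, ∀ y : N, ϖ ^ k • y = 0 → y = 0 := by
    intro k
    induction k with
    | zero => simp
    | succ k ih =>
      intro y hy
      rw [pow_succ', mul_smul] at hy
      exact ih y (htf _ hy)
  exact sub_eq_zero.1 (this k _ hc')

end FractionField

/-! ### The completion for linear growth of a torsion-free algebra. -/

section TensorDagger

variable {V : Type*} [CommRing V] (K : Type*) [Field K] [Algebra V K]
  (ϖ : V) {A : Type*} [CommRing A] [Algebra V A] {F : Submodule V A} (h1 : (1 : A) ∈ F)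

/-- The submodule of all `ϖ ^ (-k) ⊗ z` with `z ∈ mwSubmodule ϖ h1 c`. -/
noncomputable def mwLattice (k c : ℕ) : Submodule V (K ⊗[V] dagger ϖ A) :=
  (mwSubmodule ϖ h1 c).map (TensorProduct.mk V K (dagger ϖ A) ((algebraMap V K ϖ)⁻¹ ^ k))

variable {K ϖ h1}

theorem mem_mwLattice {k c : ℕ} {x : K ⊗[V] dagger ϖ A} :
    x ∈ mwLattice K ϖ h1 k c ↔
      ∃ z ∈ mwSubmodule ϖ h1 c, ((algebraMap V K ϖ)⁻¹ ^ k) ⊗ₜ[V] z = x :=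
  Iff.rfl

variable [IsDomain V] [IsDiscreteValuationRing V] [IsFractionRing V K]

/-- A finitely generated submodule of `K` lies in `ϖ ^ (-k) V`, so the tensor product bornology has
these lattices as a cofinal family. -/
theorem tensor_daggerBornology_bounded_iff (hϖ : Irreducible ϖ) (hF : F.FG) (hgen : ∀ a, ∃ n, a ∈ F ^ n)
    {S : Set (K ⊗[V] dagger ϖ A)} :
    ((ConvexBornology.fine V K).tensor (daggerBornology ϖ A)).Bounded S ↔
      ∃ k c : ℕ, S ⊆ mwLattice K ϖ h1 k c := by
  rw [ConvexBornology.tensor, ConvexBornology.bounded_ofBounded_iff]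
  constructor
  · rintro ⟨P, Q, hP, hQ, hS⟩
    rw [ConvexBornology.fine, ConvexBornology.bounded_ofBounded_iff] at hP
    obtain ⟨P', hP', hPP⟩ := hP
    obtain ⟨c, hc⟩ := (daggerBornology_bounded_iff hF h1 hgen).1 hQ
    obtain ⟨k, hk⟩ := exists_forall_eq_inv_pow_mul K hϖ hP'
    suffices LinearMap.range (TensorProduct.mapIncl P Q) ≤ mwLattice K ϖ h1 k c from
      ⟨k, c, hS.trans this⟩
    rw [TensorProduct.range_mapIncl, Submodule.map₂_le]
    intro x hx y hy
    obtain ⟨v, rfl⟩ := hk x (hPP hx)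
    refine mem_mwLattice.2 ⟨v • y, Submodule.smul_mem _ _ (hc hy), ?_⟩
    rw [mul_comm, ← Algebra.smul_def, TensorProduct.mk_apply, TensorProduct.smul_tmul]
  · rintro ⟨k, c, hS⟩
    refine ⟨Submodule.span V {(algebraMap V K ϖ)⁻¹ ^ k}, mwSubmodule ϖ h1 c,
      (ConvexBornology.bounded_singleton _ _).span,
      (daggerBornology_bounded_iff hF h1 hgen).2 ⟨c, le_rfl⟩, fun x hx => ?_⟩
    rw [TensorProduct.range_mapIncl]
    obtain ⟨z, hz, rfl⟩ := mem_mwLattice.1 (hS hx)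
    exact Submodule.apply_mem_map₂ _ (Submodule.mem_span_singleton_self _) hz

theorem isVectorSpaceBornology_tensor_dagger (hϖ : Irreducible ϖ) (hF : F.FG) (h1 : (1 : A) ∈ F)
    (hgen : ∀ a, ∃ n, a ∈ F ^ n) :
    IsVectorSpaceBornology K ϖ ((ConvexBornology.fine V K).tensor (daggerBornology ϖ A)) := by
  intro S hS
  obtain ⟨k, c, h⟩ := (tensor_daggerBornology_bounded_iff (h1 := h1) hϖ hF hgen).1 hS
  refine (tensor_daggerBornology_bounded_iff (h1 := h1) hϖ hF hgen).2 ⟨k + 1, c, ?_⟩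
  rintro _ ⟨x, hx, rfl⟩
  obtain ⟨z, hz, rfl⟩ := mem_mwLattice.1 (h hx)
  exact ⟨z, hz, by rw [pow_succ']; rfl⟩

theorem isAlgebraBornology_tensor_dagger (hϖ : Irreducible ϖ) (hF : F.FG) (h1 : (1 : A) ∈ F)
    (hgen : ∀ a, ∃ n, a ∈ F ^ n) :
    IsAlgebraBornology ((ConvexBornology.fine V K).tensor (daggerBornology ϖ A)) := by
  intro S T hS hT
  obtain ⟨k, c, h⟩ := (tensor_daggerBornology_bounded_iff (h1 := h1) hϖ hF hgen).1 hS
  obtain ⟨k', c', h'⟩ := (tensor_daggerBornology_bounded_iff (h1 := h1) hϖ hF hgen).1 hT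
  refine (tensor_daggerBornology_bounded_iff (h1 := h1) hϖ hF hgen).2
    ⟨k + k', c + 1 + (c' + 1), ?_⟩
  rintro _ ⟨x, hx, y, hy, rfl⟩
  obtain ⟨z, hz, rfl⟩ := mem_mwLattice.1 (h hx)
  obtain ⟨z', hz', rfl⟩ := mem_mwLattice.1 (h' hy)
  refine mem_mwLattice.2 ⟨z * z', mul_mem_mwSubmodule h1 hz hz', ?_⟩
  dsimp only
  rw [Algebra.TensorProduct.tmul_mul_tmul, pow_add]

theorem inv_pow_tmul_injective (hϖ : Irreducible ϖ) (htf : ∀ a : A, ϖ • a = 0 → a = 0) {k : ℕ} {z z' : dagger ϖ A}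
    (h : ((algebraMap V K ϖ)⁻¹ ^ k) ⊗ₜ[V] z = ((algebraMap V K ϖ)⁻¹ ^ k) ⊗ₜ z') : z = z' := by
  refine one_tmul_injective K hϖ (fun _ => dagger_smul_eq_zero htf) ?_
  have h' := congrArg (fun x => (algebraMap V K ϖ) ^ k • x) h
  have hp := algebraMap_uniformizer_ne_zero K hϖ
  simpa [TensorProduct.smul_tmul', ← mul_pow, hp] using h'

theorem isCompleteBorn_tensor_dagger (hϖ : Irreducible ϖ) (hF : F.FG) (h1 : (1 : A) ∈ F)
    (hgen : ∀ a, ∃ n, a ∈ F ^ n) (htf : ∀ a : A, ϖ • a = 0 → a = 0) :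
    IsCompleteBorn ϖ ((ConvexBornology.fine V K).tensor (daggerBornology ϖ A)) := by
  refine isCompleteBorn_of_series (fun E hE x hx => ?_) fun S hS => ?_
  · obtain ⟨k, c, h⟩ := (tensor_daggerBornology_bounded_iff (h1 := h1) hϖ hF hgen).1 hE
    -- All powers of `ϖ` are extracted from the same denominator `ϖ ^ k`, so `z 0 = ϖ ^ n • z n` for
    -- all `n`, and `z 0` vanishes because the adic completion is separated.
    have hx' : ∀ n, ∃ z : dagger ϖ A, x = ((algebraMap V K ϖ)⁻¹ ^ k) ⊗ₜ[V] (ϖ ^ n • z) := by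
      intro n
      obtain ⟨e, he, rfl⟩ := (Submodule.mem_smul_pointwise_iff_exists _ _ _).1 (hx n)
      obtain ⟨z, -, rfl⟩ := mem_mwLattice.1 (h he)
      exact ⟨z, (TensorProduct.tmul_smul _ _ _).symm⟩
    choose z hz using hx'
    have h0 : z 0 = 0 := by
      refine Subtype.ext (eq_zero_of_forall_eq_pow_smul fun n => ⟨z n, ?_⟩)
      have := inv_pow_tmul_injective hϖ htf ((hz 0).symm.trans (hz n))
      rw [pow_zero, one_smul] at this
      exact congrArg Subtype.val this
    rw [hz 0, h0, smul_zero, TensorProduct.tmul_zero]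
  · obtain ⟨k, c, h⟩ := (tensor_daggerBornology_bounded_iff (h1 := h1) hϖ hF hgen).1 hS
    refine ⟨mwLattice K ϖ h1 k c,
      (tensor_daggerBornology_bounded_iff (h1 := h1) hϖ hF hgen).2 ⟨k, c, le_rfl⟩, h,
      fun d hd => ?_⟩
    choose d' hd' hdd using fun i => mem_mwLattice.1 (hd i)
    obtain ⟨z, hz⟩ := exists_series_mwSubmodule h1 hF hd'
    refine ⟨((algebraMap V K ϖ)⁻¹ ^ k) ⊗ₜ z, fun n => ?_⟩
    obtain ⟨e, he, hze⟩ := hz n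
    refine (Submodule.mem_smul_pointwise_iff_exists _ _ _).2
      ⟨_, mem_mwLattice.2 ⟨e, he, rfl⟩, ?_⟩
    rw [← TensorProduct.tmul_smul, ← hze, TensorProduct.tmul_sub, TensorProduct.tmul_sum]
    simp only [TensorProduct.tmul_smul, hdd]

/-- Let the `V`-algebra `A` be torsion-free and of finite type. If `W` is a `K`-vector space with
`W = K · A`, then `K ⊗ dagger A` is the completion of `W` with respect to the
bornology generated by the submodules `ϖ ^ (-k) ∑ⱼ ϖ ^ j F ^ (c (j + 1))`. -/
theorem isCompletion_tensor_dagger (hϖ : Irreducible ϖ) (hF : F.FG) (h1 : (1 : A) ∈ F)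
    (hgen : ∀ a, ∃ n, a ∈ F ^ n) (htf : ∀ a : A, ϖ • a = 0 → a = 0)
    {W : Type*} [AddCommGroup W] [Module V W] [Module K W] [IsScalarTower V K W]
    (j : A →ₗ[V] W) (hj : ∀ x : W, ∃ (k : ℕ) (a : A), algebraMap V K ϖ ^ k • x = j a)
    (ι : W →ₗ[K] K ⊗[V] dagger ϖ A) (hι : ∀ a, ι (j a) = 1 ⊗ₜ toDagger ϖ A a)
    {B : ConvexBornology V W}
    (hB : ∀ S, B.Bounded S ↔
      ∃ k c : ℕ, ∀ x ∈ S, ∃ a ∈ linearGrowth ϖ F c, algebraMap V K ϖ ^ k • x = j a) :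
    IsCompletion.{w} ϖ B ((ConvexBornology.fine V K).tensor (daggerBornology ϖ A))
      (ι.restrictScalars V) := by
  have hp := algebraMap_uniformizer_ne_zero K hϖ
  have hι' : ∀ (k : ℕ) (x : W) (a : A), algebraMap V K ϖ ^ k • x = j a →
      ι x = ((algebraMap V K ϖ)⁻¹ ^ k) ⊗ₜ[V] toDagger ϖ A a := by
    intro k x a h
    have h' := congrArg (fun y => (algebraMap V K ϖ)⁻¹ ^ k • ι y) h
    simpa [smul_smul, ← mul_pow, hp, hι, TensorProduct.smul_tmul'] using h'
  have hV : ∀ (k : ℕ) (x : W), ϖ ^ k • x = algebraMap V K ϖ ^ k • x := by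
    intro k x
    rw [← map_pow, algebraMap_smul]
  have hV' : ∀ (k : ℕ) (x : K ⊗[V] dagger ϖ A), ϖ ^ k • x = algebraMap V K ϖ ^ k • x := by
    intro k x
    rw [← map_pow, algebraMap_smul]
  have hcan : ∀ (k : ℕ) {x y : W}, algebraMap V K ϖ ^ k • x = algebraMap V K ϖ ^ k • y → x = y :=
    fun k x y h => (IsUnit.mk0 _ (pow_ne_zero k hp)).smul_left_cancel.1 h
  have hcan' : ∀ (k : ℕ) {x y : K ⊗[V] dagger ϖ A},
      algebraMap V K ϖ ^ k • x = algebraMap V K ϖ ^ k • y → x = y :=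
    fun k x y h => (IsUnit.mk0 _ (pow_ne_zero k hp)).smul_left_cancel.1 h
  refine isCompletion_of_dense_embedding (isCompleteBorn_tensor_dagger hϖ hF h1 hgen htf)
    (fun S hS => ?_) (fun Q hQ => ?_) fun S hS => ?_
  · obtain ⟨k, c, h⟩ := (hB S).1 hS
    refine (tensor_daggerBornology_bounded_iff (h1 := h1) hϖ hF hgen).2 ⟨k, c, ?_⟩
    rintro _ ⟨x, hx, rfl⟩
    obtain ⟨a, ha, e⟩ := h x hx
    exact mem_mwLattice.2 ⟨_, toDagger_mem_mwSubmodule h1 ha, (hι' k x a e).symm⟩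
  · obtain ⟨k, c, h⟩ := (tensor_daggerBornology_bounded_iff (h1 := h1) hϖ hF hgen).1 hQ
    obtain ⟨c', hc'⟩ := exists_mem_linearGrowth hF h1 hgen htf c
    -- The witness is `ϖ ^ (-k) j(linearGrowth ϖ F c')`.
    refine ⟨((linearGrowth ϖ F c').map j).comap (ϖ ^ k • LinearMap.id),
      (hB _).2 ⟨k, c', ?_⟩, fun n u hu => ?_⟩
    · rintro x ⟨a, ha, e⟩
      refine ⟨a, ha, ?_⟩
      rw [← hV, e]
      rfl
    · obtain ⟨q, hq, e⟩ := (Submodule.mem_smul_pointwise_iff_exists _ _ _).1 hu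
      obtain ⟨d, hd, rfl⟩ := mem_mwLattice.1 (h hq)
      set u' := (algebraMap V K ϖ)⁻¹ ^ n • u with hu'
      have huu : ϖ ^ n • u' = u := by
        rw [hV, hu', smul_smul, ← mul_pow, mul_inv_cancel₀ hp, one_pow, one_smul]
      rw [← huu]
      refine Submodule.smul_mem_pointwise_smul _ _ _ ?_
      have hιu : ι u' = ((algebraMap V K ϖ)⁻¹ ^ k) ⊗ₜ[V] d := by
        refine hcan' n ?_
        rw [← map_smul, ← hV, huu, ← hV', e]
        rfl
      -- A priori `ϖ ^ k • u'` lies only in `ϖ ^ (-m) j(A)`. Its image has no denominator, so the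
      -- numerator `t` is divisible by `ϖ ^ m` in the completion and therefore in `A`.
      obtain ⟨m, t, ht⟩ := hj (algebraMap V K ϖ ^ k • u')
      have h2 := hι' m _ t ht
      have h3 : ι (algebraMap V K ϖ ^ k • u') = ((algebraMap V K ϖ)⁻¹ ^ m) ⊗ₜ[V] (ϖ ^ m • d) := by
        rw [map_smul, hιu, TensorProduct.tmul_smul, TensorProduct.smul_tmul',
          TensorProduct.smul_tmul', ← algebraMap_smul K (ϖ ^ m), map_pow, smul_eq_mul, smul_eq_mul,
          ← mul_pow, ← mul_pow, mul_inv_cancel₀ hp, one_pow, one_pow]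
      have h4 : toDagger ϖ A t = ϖ ^ m • d := inv_pow_tmul_injective hϖ htf (h2.symm.trans h3)
      obtain ⟨t', rfl⟩ := exists_eq_pow_smul_of_algebraMap_eq (congrArg Subtype.val h4)
      have h5 : algebraMap V K ϖ ^ k • u' = j t' := by
        refine hcan m ?_
        rw [ht, map_smul, hV]
      have h6 : toDagger ϖ A t' = d :=
        inv_pow_tmul_injective hϖ htf ((hι' k u' t' h5).symm.trans hιu)
      refine ⟨t', hc' t' (h6 ▸ hd), ?_⟩
      rw [← h5, ← hV]
      rfl
  · obtain ⟨k, c, h⟩ := (tensor_daggerBornology_bounded_iff (h1 := h1) hϖ hF hgen).1 hS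
    refine ⟨mwLattice K ϖ h1 k (2 * c),
      (tensor_daggerBornology_bounded_iff (h1 := h1) hϖ hF hgen).2 ⟨k, _, le_rfl⟩,
      fun x hx n => ?_⟩
    obtain ⟨z, hz, rfl⟩ := mem_mwLattice.1 (h hx)
    obtain ⟨a, e, he, hze⟩ := exists_partialSum_mwSubmodule h1 hF hz n
    refine ⟨(algebraMap V K ϖ)⁻¹ ^ k • j a, (Submodule.mem_smul_pointwise_iff_exists _ _ _).2
      ⟨_, mem_mwLattice.2 ⟨e, he, rfl⟩, ?_⟩⟩
    rw [LinearMap.restrictScalars_apply, hι' k _ a (by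
      rw [smul_smul, ← mul_pow, mul_inv_cancel₀ hp, one_pow, one_smul]), ← TensorProduct.tmul_smul,
      ← hze, TensorProduct.tmul_sub]

end TensorDagger

/-! ### Generating submodules of the algebra and of the ideal. -/

section FiniteType

variable {V : Type*} [CommRing V] {R : Type*} [CommRing R] [Algebra V R]

theorem exists_fg_submodule_forall_mem_pow [Algebra.FiniteType V R] :
    ∃ N : Submodule V R, N.FG ∧ (1 : R) ∈ N ∧ ∀ a, ∃ n, a ∈ N ^ n := by
  obtain ⟨s, hs⟩ := (Algebra.FiniteType.out : (⊤ : Subalgebra V R).FG)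
  have h1 : (1 : R) ∈ Submodule.span V (insert 1 (s : Set R)) :=
    Submodule.subset_span (Set.mem_insert _ _)
  refine ⟨Submodule.span V (insert 1 (s : Set R)),
    Submodule.fg_span (s.finite_toSet.insert 1), h1, fun a => ?_⟩
  have ha : a ∈ Algebra.adjoin V (s : Set R) := hs ▸ Algebra.mem_top
  induction ha using Algebra.adjoin_induction with
  | mem x hx =>
    exact ⟨1, by rw [pow_one]; exact Submodule.subset_span (Set.mem_insert_of_mem _ hx)⟩
  | algebraMap r =>
    exact ⟨0, by rw [pow_zero]; exact Submodule.algebraMap_mem r⟩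
  | add x y _ _ hx hy =>
    obtain ⟨m, hm⟩ := hx
    obtain ⟨n, hn⟩ := hy
    exact ⟨max m n, add_mem (pow_le_pow_of_one_mem h1 (le_max_left _ _) hm)
      (pow_le_pow_of_one_mem h1 (le_max_right _ _) hn)⟩
  | mul x y _ _ hx hy =>
    obtain ⟨m, hm⟩ := hx
    obtain ⟨n, hn⟩ := hy
    exact ⟨m + n, by rw [pow_add]; exact Submodule.mul_mem_mul hm hn⟩

theorem exists_fg_submodule_span_eq [IsNoetherianRing R] (J : Ideal R) :
    ∃ M : Submodule V R, M.FG ∧ Ideal.span (M : Set R) = J := by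
  obtain ⟨s, rfl⟩ := IsNoetherian.noetherian J
  refine ⟨Submodule.span V s, Submodule.fg_span s.finite_toSet, le_antisymm ?_ ?_⟩
  · refine Ideal.span_le.2 fun x hx => ?_
    have : Submodule.span V (s : Set R) ≤ (Ideal.span (s : Set R)).restrictScalars V :=
      Submodule.span_le.2 Submodule.subset_span
    exact this hx
  · exact Ideal.span_mono Submodule.subset_span

theorem pow_mul_mono {N P : Submodule V R} (h1 : (1 : R) ∈ N) {m n : ℕ} (h : m ≤ n) :
    N ^ m * P ≤ N ^ n * P :=
  mul_le_mul_left (pow_le_pow_of_one_mem h1 h) P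

theorem le_pow_mul {N P : Submodule V R} (h1 : (1 : R) ∈ N) (n : ℕ) : P ≤ N ^ n * P := by
  have := pow_mul_mono (P := P) h1 (Nat.zero_le n)
  rwa [pow_zero, one_mul] at this

theorem exists_mem_pow_mul_of_mem_span {N M : Submodule V R} (h1 : (1 : R) ∈ N)
    (hgen : ∀ a, ∃ n, a ∈ N ^ n) {y : R} (hy : y ∈ Ideal.span (M : Set R)) :
    ∃ h, y ∈ N ^ h * M := by
  induction hy using Submodule.span_induction with
  | mem x hx => exact ⟨0, le_pow_mul h1 0 hx⟩
  | zero => exact ⟨0, zero_mem _⟩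
  | add x y _ _ hx hy =>
    obtain ⟨m, hm⟩ := hx
    obtain ⟨n, hn⟩ := hy
    exact ⟨max m n, add_mem (pow_mul_mono h1 (le_max_left _ _) hm)
      (pow_mul_mono h1 (le_max_right _ _) hn)⟩
  | smul r x _ hx =>
    obtain ⟨m, hm⟩ := hx
    obtain ⟨n, hn⟩ := hgen r
    refine ⟨n + m, ?_⟩
    rw [pow_add, mul_assoc]
    exact Submodule.mul_mem_mul hn hm

theorem exists_mem_pow_mul_pow {N M : Submodule V R} (h1 : (1 : R) ∈ N)
    (hgen : ∀ a, ∃ n, a ∈ N ^ n) (n : ℕ) {y : R} (hy : y ∈ Ideal.span (M : Set R) ^ n) :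
    ∃ h, y ∈ N ^ h * M ^ n := by
  induction n generalizing y with
  | zero => simpa using hgen y
  | succ n ih =>
    rw [pow_succ] at hy
    induction hy using Submodule.mul_induction_on' with
    | mem_mul_mem a ha b hb =>
      obtain ⟨h, hh⟩ := ih ha
      obtain ⟨h', hh'⟩ := exists_mem_pow_mul_of_mem_span h1 hgen hb
      refine ⟨h + h', ?_⟩
      rw [pow_add, pow_succ, mul_mul_mul_comm]
      exact Submodule.mul_mem_mul hh hh'
    | add x _ y _ hx hy =>
      obtain ⟨m, hm⟩ := hx
      obtain ⟨n, hn⟩ := hy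
      exact ⟨max m n, add_mem (pow_mul_mono h1 (le_max_left _ _) hm)
        (pow_mul_mono h1 (le_max_right _ _) hn)⟩

theorem exists_le_pow_mul_of_fg {N M P : Submodule V R} (h1 : (1 : R) ∈ N)
    (hgen : ∀ a, ∃ n, a ∈ N ^ n) (hP : P.FG) (hPM : ∀ x ∈ P, x ∈ Ideal.span (M : Set R)) :
    ∃ h, P ≤ N ^ h * M := by
  have : ∀ x, ∃ h, x ∈ P → x ∈ N ^ h * M := fun x => by
    by_cases hx : x ∈ P
    · obtain ⟨h, hh⟩ := exists_mem_pow_mul_of_mem_span h1 hgen (hPM x hx)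
      exact ⟨h, fun _ => hh⟩
    · exact ⟨0, fun h => absurd h hx⟩
  choose d hd using this
  obtain ⟨s, rfl⟩ := hP
  exact ⟨s.sup d, Submodule.span_le.2 fun x hx =>
    pow_mul_mono h1 (Finset.le_sup (f := d) hx) (hd x (Submodule.subset_span hx))⟩

end FiniteType

/-! ### The submodules `ϖ ^ e P` of `R_K`. -/

section Scaled

variable {V : Type*} [CommRing V] (K : Type*) [Field K] [Algebra V K]
  {R : Type*} [CommRing R] [Algebra V R] (ϖ : V)

/-- The submodule `ϖ ^ e P` of `R_K`. -/
noncomputable def scaledImage (e : ℤ) (P : Submodule V R) : Submodule V (K ⊗[V] R) :=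
  (algebraMap V K ϖ ^ e) • imageK K P

variable {K ϖ}

theorem mem_scaledImage {e : ℤ} {P : Submodule V R} {x : K ⊗[V] R} :
    x ∈ scaledImage K ϖ e P ↔ ∃ y ∈ P,
      (algebraMap V K ϖ ^ e) • (Algebra.TensorProduct.includeRight : R →ₐ[V] K ⊗[V] R) y = x := by
  rw [scaledImage, Submodule.mem_smul_pointwise_iff_exists]
  constructor
  · rintro ⟨_, ⟨y, hy, rfl⟩, rfl⟩
    exact ⟨y, hy, rfl⟩
  · rintro ⟨y, hy, rfl⟩
    exact ⟨_, ⟨y, hy, rfl⟩, rfl⟩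

theorem scaledImage_mono (e : ℤ) {P Q : Submodule V R} (h : P ≤ Q) :
    scaledImage K ϖ e P ≤ scaledImage K ϖ e Q :=
  Submodule.map_mono (Submodule.map_mono h)

theorem scaledImage_fg (e : ℤ) {P : Submodule V R} (h : P.FG) : (scaledImage K ϖ e P).FG :=
  (h.map _).map _

theorem scaledImage_zero (P : Submodule V R) : scaledImage K ϖ 0 P = imageK K P := by
  rw [scaledImage, zpow_zero, one_smul]

theorem scaledImage_mul (hp : algebraMap V K ϖ ≠ 0) (e e' : ℤ) (P Q : Submodule V R) :
    scaledImage K ϖ e P * scaledImage K ϖ e' Q = scaledImage K ϖ (e + e') (P * Q) := by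
  refine le_antisymm (Submodule.mul_le.2 ?_) ?_
  · rintro x hx y hy
    obtain ⟨a, ha, rfl⟩ := mem_scaledImage.1 hx
    obtain ⟨b, hb, rfl⟩ := mem_scaledImage.1 hy
    refine mem_scaledImage.2 ⟨a * b, Submodule.mul_mem_mul ha hb, ?_⟩
    rw [map_mul, smul_mul_smul_comm, zpow_add₀ hp]
  · intro x hx
    obtain ⟨y, hy, rfl⟩ := mem_scaledImage.1 hx
    induction hy using Submodule.mul_induction_on' with
    | mem_mul_mem a ha b hb =>
      rw [map_mul, zpow_add₀ hp, ← smul_mul_smul_comm]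
      exact Submodule.mul_mem_mul (mem_scaledImage.2 ⟨a, ha, rfl⟩) (mem_scaledImage.2 ⟨b, hb, rfl⟩)
    | add a ha b hb h h' =>
      rw [map_add, smul_add]
      exact add_mem (h (mem_scaledImage.2 ⟨a, ha, rfl⟩)) (h' (mem_scaledImage.2 ⟨b, hb, rfl⟩))

theorem scaledImage_add_natCast (hp : algebraMap V K ϖ ≠ 0) (e : ℤ) (d : ℕ) (P : Submodule V R) :
    scaledImage K ϖ (e + d) P = ϖ ^ d • scaledImage K ϖ e P := by
  ext x
  rw [mem_scaledImage, Submodule.mem_smul_pointwise_iff_exists]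
  constructor
  · rintro ⟨y, hy, rfl⟩
    refine ⟨_, mem_scaledImage.2 ⟨y, hy, rfl⟩, ?_⟩
    rw [add_comm, zpow_add₀ hp, mul_smul, zpow_natCast, ← map_pow, algebraMap_smul]
  · rintro ⟨_, hz, rfl⟩
    obtain ⟨y, hy, rfl⟩ := mem_scaledImage.1 hz
    refine ⟨y, hy, ?_⟩
    rw [add_comm, zpow_add₀ hp, mul_smul, zpow_natCast, ← map_pow, algebraMap_smul]

theorem smul_mem_scaledImage {e d : ℤ} (hp : algebraMap V K ϖ ≠ 0) {P : Submodule V R}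
    {x : K ⊗[V] R} (hx : x ∈ scaledImage K ϖ e P) :
    (algebraMap V K ϖ ^ d) • x ∈ scaledImage K ϖ (d + e) P := by
  obtain ⟨y, hy, rfl⟩ := mem_scaledImage.1 hx
  exact mem_scaledImage.2 ⟨y, hy, by rw [zpow_add₀ hp, mul_smul]⟩

/-- Powers of `ϖ` may be moved from the scalar factor into the submodule, which is how surplus
powers get absorbed into elements of `J`. -/
theorem scaledImage_pow_smul_le (hp : algebraMap V K ϖ ≠ 0) {e e' : ℤ} {b : ℕ} (h : e' + b ≤ e)
    {P Q : Submodule V R} (hPQ : ϖ ^ b • P ≤ Q) :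
    scaledImage K ϖ e P ≤ scaledImage K ϖ e' Q := by
  intro x hx
  obtain ⟨y, hy, rfl⟩ := mem_scaledImage.1 hx
  obtain ⟨d, rfl⟩ := Int.le.dest h
  refine mem_scaledImage.2 ⟨ϖ ^ d • ϖ ^ b • y,
    Q.smul_mem _ (hPQ (Submodule.smul_mem_pointwise_smul _ _ _ hy)), ?_⟩
  rw [map_smul, map_smul, zpow_add₀ hp, zpow_add₀ hp, zpow_natCast, zpow_natCast,
    ← algebraMap_smul K (ϖ ^ d), ← algebraMap_smul K (ϖ ^ b), smul_smul, smul_smul, map_pow, map_pow]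
  congr 1
  ring

theorem scaledImage_anti (hp : algebraMap V K ϖ ≠ 0) {e e' : ℤ} (h : e' ≤ e) (P : Submodule V R) :
    scaledImage K ϖ e P ≤ scaledImage K ϖ e' P :=
  scaledImage_pow_smul_le hp (b := 0) (by simpa using h) (by simp)

theorem exists_pow_smul_eq_includeRight [IsDomain V] [IsDiscreteValuationRing V]
    [IsFractionRing V K] (hϖ : Irreducible ϖ) (x : K ⊗[V] R) :
    ∃ (k : ℕ) (r : R), algebraMap V K ϖ ^ k • x =
      (Algebra.TensorProduct.includeRight : R →ₐ[V] K ⊗[V] R) r := by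
  have hp := algebraMap_uniformizer_ne_zero K hϖ
  induction x using TensorProduct.induction_on with
  | zero => exact ⟨0, 0, by simp⟩
  | tmul a r =>
    obtain ⟨k, v, rfl⟩ := exists_eq_inv_pow_mul K hϖ a
    refine ⟨k, v • r, ?_⟩
    rw [TensorProduct.smul_tmul', smul_eq_mul, ← mul_assoc, ← mul_pow, mul_inv_cancel₀ hp, one_pow,
      one_mul, Algebra.algebraMap_eq_smul_one, TensorProduct.smul_tmul]
    rfl
  | add x y hx hy =>
    obtain ⟨k, r, h⟩ := hx
    obtain ⟨l, s, h'⟩ := hy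
    refine ⟨k + l, ϖ ^ l • r + ϖ ^ k • s, ?_⟩
    rw [smul_add, map_add, map_smul, map_smul, ← h, ← h', ← algebraMap_smul K (ϖ ^ l),
      ← algebraMap_smul K (ϖ ^ k), map_pow, map_pow, smul_smul, smul_smul, ← pow_add, ← pow_add,
      add_comm l k]

end Scaled

/-! ### Finite generation of the tube algebra. -/

section TubeGenerators

variable {V : Type*} [CommRing V] (K : Type*) [Field K] [Algebra V K]
  {R : Type*} [CommRing R] [Algebra V R] (ϖ : V)

/-- The submodule `∑ ϖ ^ ⌈-α l⌉ N M ^ l` of `R_K`, where `l ≤ q`. If `N` generates the algebra `R`,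
`M` generates the ideal `J`, and `α q` is an integer, then it generates the `α`-tube algebra. -/
noncomputable def tubeGenerators (α : ℝ) (q : ℕ) (N M : Submodule V R) : Submodule V (K ⊗[V] R) :=
  ⨆ l ∈ Finset.range (q + 1), scaledImage K ϖ ⌈-(α * l)⌉ (N * M ^ l)

variable {K ϖ} {α : ℝ} {q : ℕ} {N M : Submodule V R}

theorem le_tubeGenerators {l : ℕ} (hl : l ≤ q) :
    scaledImage K ϖ ⌈-(α * l)⌉ (N * M ^ l) ≤ tubeGenerators K ϖ α q N M :=
  le_iSup₂_of_le l (Finset.mem_range.2 (Nat.lt_succ_of_le hl)) le_rfl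

theorem tubeGenerators_fg (hN : N.FG) (hM : M.FG) : (tubeGenerators K ϖ α q N M).FG :=
  Submodule.fg_biSup _ _ fun l _ => scaledImage_fg _ (hN.mul (hM.pow l))

theorem imageK_le_tubeGenerators : imageK K N ≤ tubeGenerators K ϖ α q N M := by
  have := le_tubeGenerators (K := K) (ϖ := ϖ) (α := α) (N := N) (M := M) (Nat.zero_le q)
  simpa [scaledImage_zero] using this

theorem one_mem_tubeGenerators (h1 : (1 : R) ∈ N) :
    (1 : K ⊗[V] R) ∈ tubeGenerators K ϖ α q N M :=
  imageK_le_tubeGenerators ⟨1, h1, map_one (Algebra.TensorProduct.includeRight : R →ₐ[V] K ⊗[V] R)⟩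

theorem imageK_pow (n : ℕ) : imageK K (N ^ n) = imageK K N ^ n :=
  Submodule.map_pow _ _ _

/-- Subadditivity of the ceiling suffices for this direction; no integrality of `α q` is needed. -/
theorem tubeGenerators_pow_le (hp : algebraMap V K ϖ ≠ 0) (m : ℕ) :
    tubeGenerators K ϖ α q N M ^ m ≤
      ⨆ l ∈ Finset.range (q * m + 1), scaledImage K ϖ ⌈-(α * l)⌉ (N ^ m * M ^ l) := by
  induction m with
  | zero =>
    refine le_iSup₂_of_le 0 (by simp) ?_
    simp only [pow_zero, Nat.cast_zero, mul_zero, neg_zero, Int.ceil_zero, scaledImage_zero,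
      mul_one]
    exact (Submodule.map_one _).ge
  | succ m ih =>
    rw [pow_succ]
    refine (mul_le_mul_left ih _).trans ?_
    simp only [tubeGenerators, Submodule.iSup_mul, Submodule.mul_iSup, iSup_le_iff,
      scaledImage_mul hp, Finset.mem_range]
    intro l hl k hk
    refine le_iSup₂_of_le (k + l) (by rw [mul_add_one]; omega) ?_
    rw [mul_mul_mul_comm, ← pow_succ, ← pow_add]
    refine scaledImage_anti hp ?_ _
    refine le_trans (le_of_eq ?_) (Int.ceil_add_le _ _)
    congr 1
    push_cast
    ring

/-- Blocks `M ^ q` are split off until fewer than `q` factors `M` remain. Integrality of `α q` makes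
the ceilings add up exactly, so no power of `ϖ` is lost. Each block costs one factor, the rest one
more, and `N ^ h` costs `h`. -/
theorem scaledImage_le_tubeGenerators_pow (hp : algebraMap V K ϖ ≠ 0) (h1 : (1 : R) ∈ N)
    (hq : 0 < q) {a : ℤ} (ha : α * q = a) (h n : ℕ) :
    scaledImage K ϖ ⌈-(α * n)⌉ (N ^ h * M ^ n) ≤ tubeGenerators K ϖ α q N M ^ (n + 1 + h) := by
  induction n using Nat.strong_induction_on with
  | _ n ih =>
    have hle : ∀ l, l ≤ q → scaledImage K ϖ ⌈-(α * l)⌉ (M ^ l) ≤ tubeGenerators K ϖ α q N M :=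
      fun l hl => (scaledImage_mono _ (by simpa using le_pow_mul (P := M ^ l) h1 1)).trans
        (le_tubeGenerators hl)
    rcases lt_or_ge n q with hn | hn
    · have e : scaledImage K ϖ ⌈-(α * n)⌉ (N ^ h * M ^ n) =
          scaledImage K ϖ ⌈-(α * n)⌉ (M ^ n) * imageK K N ^ h := by
        rw [← imageK_pow, ← scaledImage_zero (ϖ := ϖ), scaledImage_mul hp, add_zero,
          mul_comm (M ^ n)]
      rw [e, pow_add]
      refine mul_le_mul' ?_ (pow_le_pow_left' imageK_le_tubeGenerators h)
      exact (hle n hn.le).trans (by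
        simpa using pow_le_pow_of_one_mem (one_mem_tubeGenerators h1) (Nat.le_add_left 1 n))
    · obtain ⟨m, rfl⟩ := Nat.exists_eq_add_of_le' hn
      have e : scaledImage K ϖ ⌈-(α * (m + q : ℕ))⌉ (N ^ h * M ^ (m + q)) =
          scaledImage K ϖ ⌈-(α * m)⌉ (N ^ h * M ^ m) * scaledImage K ϖ ⌈-(α * q)⌉ (M ^ q) := by
        rw [scaledImage_mul hp, mul_assoc, ← pow_add]
        congr 1
        rw [ha, ← Int.cast_neg, Int.ceil_intCast, ← Int.ceil_add_intCast]
        congr 1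
        push_cast
        rw [← ha]
        ring
      rw [e]
      refine (mul_le_mul' (ih m (by omega)) (hle q le_rfl)).trans ?_
      rw [← pow_succ]
      exact pow_le_pow_of_one_mem (one_mem_tubeGenerators h1) (by omega)

end TubeGenerators

/-! ### Comparison of spectral radius conditions with linear growth. -/

section Growth

variable {V : Type*} [CommRing V] {K : Type*} [Field K] [Algebra V K]
  {R : Type*} [CommRing R] [Algebra V R] {ϖ : V} {ε : ℝ}

theorem geomSum_eq {A : Type*} [Ring A] [Algebra V A] [Algebra K A] [IsScalarTower V K A]
    (r : ℝ) (M : Submodule V A) :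
    geomSum K ϖ ε r M = ⨆ n : ℕ, (algebraMap V K ϖ ^ ⌈-(Real.logb ε r * n)⌉) • M ^ n := by
  simp only [geomSum, star, Real.logb_inv, Real.logb_pow, mul_comm]

theorem geomSum_imageK (r : ℝ) (M : Submodule V R) :
    geomSum K ϖ ε r (imageK K M) =
      ⨆ n : ℕ, scaledImage K ϖ ⌈-(Real.logb ε r * n)⌉ (M ^ n) := by
  simp only [geomSum_eq, scaledImage, imageK_pow]

theorem geomSum_imageK_anti (hp : algebraMap V K ϖ ≠ 0) (hε0 : 0 < ε) (hε1 : ε < 1) {r r' : ℝ}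
    (hr : 0 < r) (h : r ≤ r') (M : Submodule V R) :
    geomSum K ϖ ε r' (imageK K M) ≤ geomSum K ϖ ε r (imageK K M) := by
  rw [geomSum_imageK, geomSum_imageK]
  refine iSup_mono fun n => scaledImage_anti hp (Int.ceil_mono ?_) _
  have := (Real.logb_le_logb_of_base_lt_one hε0 hε1 (hr.trans_le h) hr).2 h
  gcongr

/-- The infimum only provides some admissible `r' < r`; since `geomSum` shrinks as the radius grows,
`r` is admissible too. -/
theorem bounded_geomSum_of_bornSpectralRadius_le (hp : algebraMap V K ϖ ≠ 0) (hε0 : 0 < ε)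
    (hε1 : ε < 1) {C : ConvexBornology V (K ⊗[V] R)} {M : Submodule V R} {ρ r : ℝ}
    (hρ : 0 ≤ ρ) (h : bornSpectralRadius K ϖ ε C (imageK K M) ≤ ENNReal.ofReal ρ) (hr : ρ < r) :
    C.Bounded (geomSum K ϖ ε r (imageK K M) : Set (K ⊗[V] R)) := by
  have hlt := h.trans_lt ((ENNReal.ofReal_lt_ofReal_iff (hρ.trans_lt hr)).2 hr)
  rw [bornSpectralRadius] at hlt
  simp only [iInf_lt_iff] at hlt
  obtain ⟨r', ⟨hr', hb⟩, hlt⟩ := hlt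
  exact hb.subset (geomSum_imageK_anti hp hε0 hε1 hr'
    ((ENNReal.ofReal_lt_ofReal_iff (hρ.trans_lt hr)).1 hlt).le M)

theorem bornSpectralRadius_le {A : Type*} [Ring A] [Algebra V A] [Algebra K A]
    [IsScalarTower V K A] {C : ConvexBornology V A} {M : Submodule V A} {ρ : ℝ} (hρ : 0 ≤ ρ)
    (h : ∀ r, ρ < r → C.Bounded (geomSum K ϖ ε r M : Set A)) :
    bornSpectralRadius K ϖ ε C M ≤ ENNReal.ofReal ρ := by
  by_contra! hlt
  obtain ⟨r, hr, h1, h2⟩ := ENNReal.lt_iff_exists_real_btwn.1 hlt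
  have hρr : ρ < r := ENNReal.ofReal_lt_ofReal_iff'.1 h1 |>.1
  exact absurd h2 (not_lt.2 (iInf₂_le r ⟨hρ.trans_lt hρr, h r hρr⟩))

variable {α : ℝ} {q : ℕ} {N M : Submodule V R}

/-- If the valuation grows more slowly than `α n`, then `∑ₙ r⁻ⁿ ⋆ Pⁿ` has linear growth. -/
theorem exists_geomSum_le_linearGrowth (hp : algebraMap V K ϖ ≠ 0) (h1 : (1 : R) ∈ N)
    (hq : 0 < q) {a : ℤ} (ha : α * q = a) {r : ℝ} (hr : Real.logb ε r < α) {h : ℕ}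
    {P : Submodule V R} (hP : P ≤ N ^ h * M) :
    ∃ c : ℕ, geomSum K ϖ ε r (imageK K P) ≤ linearGrowth ϖ (tubeGenerators K ϖ α q N M) c := by
  set s := Real.logb ε r with hs
  -- The `n`-th summand needs `(h + 1) * n + 1` factors of the generators and has about `(α - s) *
  -- n` spare powers of `ϖ`. The quotient of these slopes is the growth rate, and the final `+ 1`
  -- pays for the extra factor.
  refine ⟨⌈(h + 1) / (α - s)⌉₊ + 1, ?_⟩
  rw [geomSum_imageK]
  refine iSup_le fun n => ?_
  have hle : ⌈-(α * n)⌉ ≤ ⌈-(s * n)⌉ := Int.ceil_mono (by gcongr)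
  obtain ⟨j, hj⟩ := Int.le.dest hle
  have hPn : P ^ n ≤ N ^ (h * n) * M ^ n := by
    refine (pow_le_pow_left' hP n).trans (le_of_eq ?_)
    rw [mul_pow, ← pow_mul]
  refine (scaledImage_mono _ hPn).trans ?_
  rw [← hj, scaledImage_add_natCast hp]
  refine le_iSup_of_le j (Submodule.map_mono
    ((scaledImage_le_tubeGenerators_pow hp h1 hq ha (h * n) n).trans
      (pow_le_pow_of_one_mem (one_mem_tubeGenerators h1) ?_)))
  have hpos : 0 < α - s := sub_pos.2 hr
  have hn : (n : ℝ) * (α - s) ≤ j + 1 := by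
    have e1 := Int.le_ceil (-(s * n))
    have e2 := Int.ceil_lt_add_one (-(α * n))
    have e3 : (⌈-(α * n)⌉ : ℝ) + j = ⌈-(s * n)⌉ := by exact_mod_cast hj
    linarith
  have hc := Nat.le_ceil (((h : ℝ) + 1) / (α - s))
  rw [div_le_iff₀ hpos] at hc
  set c := ⌈((h : ℝ) + 1) / (α - s)⌉₊
  have : ((h : ℝ) + 1) * n ≤ c * (j + 1) := by
    have e1 : ((h : ℝ) + 1) * n ≤ c * (α - s) * n := by gcongr
    have e2 : (c : ℝ) * (n * (α - s)) ≤ c * (j + 1) := by gcongr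
    linarith
  have : (h + 1) * n ≤ c * (j + 1) := by exact_mod_cast this
  nlinarith

/-- Submodules of linear growth are contained in multiples of `∑ₙ r⁻ⁿ ⋆ Pⁿ` for some `r` with
`log_ε r < α`. -/
theorem exists_linearGrowth_le_geomSum (hp : algebraMap V K ϖ ≠ 0) (h1 : (1 : R) ∈ N)
    (hq : 0 < q) (hα0 : 0 ≤ α) (c : ℕ) :
    ∃ e : ℕ, ∃ δ : ℝ, 0 < δ ∧ ∀ r, Real.logb ε r = α - δ →
      ∀ x ∈ linearGrowth ϖ (tubeGenerators K ϖ α q N M) c,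
        algebraMap V K ϖ ^ 4 • x ∈ geomSum K ϖ ε r (imageK K (N ^ e * M ⊔ ϖ • N ^ e)) := by
  have hq' : (1 : ℝ) ≤ q := by exact_mod_cast hq
  -- Chosen so that `δ * l ≤ (j + 1) / 2` for all `l ≤ q * c * (j + 1)`: lowering `α` to `α - δ`
  -- uses at most about half of the available `ϖ ^ j`.
  set δ : ℝ := 1 / (2 * q * (c + 1)) with hδ
  have hδ0 : 0 < δ := by positivity
  refine ⟨4 * c, δ, hδ0, fun r hr => ?_⟩
  suffices h : linearGrowth ϖ (tubeGenerators K ϖ α q N M) c ≤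
      (geomSum K ϖ ε r (imageK K (N ^ (4 * c) * M ⊔ ϖ • N ^ (4 * c)))).comap
        (ϖ ^ 4 • LinearMap.id) by
    intro x hx
    rw [← map_pow, algebraMap_smul]
    exact h hx
  refine iSup_le fun j => ?_
  have hle : ϖ ^ j • tubeGenerators K ϖ α q N M ^ (c * (j + 1)) ≤
      ϖ ^ j • ⨆ l ∈ Finset.range (q * (c * (j + 1)) + 1),
        scaledImage K ϖ ⌈-(α * l)⌉ (N ^ (c * (j + 1)) * M ^ l) :=
    Submodule.map_mono (tubeGenerators_pow_le hp _)
  refine hle.trans ?_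
  simp only [Submodule.smul_iSup', iSup_le_iff, Finset.mem_range, ← scaledImage_add_natCast hp]
  intro l hl x hx
  have hx4 : ϖ ^ 4 • x ∈ scaledImage K ϖ (4 + (⌈-(α * l)⌉ + j))
      (N ^ (c * (j + 1)) * M ^ l) := by
    have := smul_mem_scaledImage (d := 4) hp hx
    rwa [zpow_ofNat, ← map_pow, algebraMap_smul] at this
  rw [Submodule.mem_comap, LinearMap.smul_apply, LinearMap.id_apply, geomSum_imageK, hr]
  -- This is the number of factors `ϖ N ^ (4c)`. They absorb `N ^ (c(j+1))` because `4b ≥ j + 1`,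
  -- and cost at most `2b ≤ j / 2 + 2` powers of `ϖ`: `b` for the factors themselves and `δ b ≤ b`
  -- for the change of radius. The prefactor `ϖ ^ 4` covers the rounding errors.
  set b := j / 4 + 1 with hb
  refine Submodule.mem_iSup_of_mem (l + b) (scaledImage_pow_smul_le hp (b := b) ?_ ?_ hx4)
  · have hb4 : 4 * (b : ℝ) ≤ j + 4 := by
      have : 4 * b ≤ j + 4 := by omega
      exact_mod_cast this
    have hδ1 : δ ≤ 1 := by
      rw [hδ, div_le_one (by positivity)]
      nlinarith [(Nat.cast_nonneg c : (0 : ℝ) ≤ c)]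
    have hl' : (l : ℝ) ≤ q * ((c + 1) * (j + 1)) := by
      have : l ≤ q * ((c + 1) * (j + 1)) :=
        (Nat.lt_succ_iff.1 hl).trans (Nat.mul_le_mul_left _ (Nat.mul_le_mul_right _ c.le_succ))
      exact_mod_cast this
    have hδl : δ * l ≤ (j + 1) / 2 := by
      calc δ * l ≤ δ * (q * ((c + 1) * (j + 1))) := by gcongr
        _ = (j + 1) / 2 := by rw [hδ]; field_simp
    have hδb : δ * b ≤ b := mul_le_of_le_one_left b.cast_nonneg hδ1
    have hαb : 0 ≤ α * b := by positivity
    have e1 := Int.ceil_lt_add_one (-((α - δ) * ((l + b : ℕ) : ℝ)))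
    have e2 := Int.le_ceil (-(α * l))
    push_cast at e1
    have : (⌈-((α - δ) * ((l + b : ℕ) : ℝ))⌉ : ℝ) + b < 4 + (⌈-(α * l)⌉ + j) + 1 := by
      push_cast
      nlinarith
    have : ⌈-((α - δ) * ((l + b : ℕ) : ℝ))⌉ + b < 4 + (⌈-(α * l)⌉ + j) + 1 := by
      exact_mod_cast this
    omega
  · have hcb : c * (j + 1) ≤ 4 * c * l + 4 * c * b := by
      have : j + 1 ≤ 4 * b := by omega
      nlinarith
    intro _ hz
    obtain ⟨y, hy, rfl⟩ := (Submodule.mem_smul_pointwise_iff_exists _ _ _).1 hz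
    clear hz
    have hy' := pow_mul_mono h1 hcb hy
    rw [pow_add, mul_right_comm, pow_mul, pow_mul _ _ b, ← mul_pow] at hy'
    clear hy
    rw [pow_add]
    have hl : (N ^ (4 * c) * M) ^ l ≤ (N ^ (4 * c) * M ⊔ ϖ • N ^ (4 * c)) ^ l :=
      pow_le_pow_left' le_sup_left l
    -- One `ϖ` is distributed to each of the `m` factors.
    have hb' : ∀ m, ϖ ^ m • (N ^ (4 * c)) ^ m ≤
        (N ^ (4 * c) * M ⊔ ϖ • N ^ (4 * c)) ^ m := by
      intro m
      induction m with
      | zero => simp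
      | succ m ih =>
        intro _ hw
        obtain ⟨z, hz, rfl⟩ := (Submodule.mem_smul_pointwise_iff_exists _ _ _).1 hw
        clear hw
        rw [pow_succ] at hz
        rw [pow_succ, pow_succ]
        induction hz using Submodule.mul_induction_on' with
        | mem_mul_mem u hu v hv =>
          rw [← smul_mul_smul_comm]
          exact Submodule.mul_mem_mul (ih (Submodule.smul_mem_pointwise_smul _ _ _ hu))
            (Submodule.mem_sup_right (Submodule.smul_mem_pointwise_smul _ _ _ hv))
        | add u hu v hv h h' =>
          rw [smul_add]
          exact add_mem h h'
    induction hy' using Submodule.mul_induction_on' with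
    | mem_mul_mem u hu v hv =>
      rw [← mul_smul_comm]
      exact Submodule.mul_mem_mul (hl hu)
        (hb' b (Submodule.smul_mem_pointwise_smul _ _ _ hv))
    | add u hu v hv h h' =>
      rw [smul_add]
      exact add_mem h h'

end Growth

/-! ### Transfer of linear growth to subalgebras of a `K`-algebra. -/

section Map

variable {V : Type*} [CommRing V] {ϖ : V} {A A' : Type*} [CommRing A] [Algebra V A] [CommRing A']
  [Algebra V A']

theorem map_linearGrowth (f : A →ₐ[V] A') (F : Submodule V A) (c : ℕ) :
    (linearGrowth ϖ F c).map f.toLinearMap = linearGrowth ϖ (F.map f.toLinearMap) c := by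
  rw [linearGrowth, linearGrowth, Submodule.map_iSup]
  refine iSup_congr fun j => ?_
  rw [Submodule.map_pointwise_smul, Submodule.map_pow]

end Map

section Subalgebra

variable {V : Type*} [CommRing V] [IsDomain V] [IsDiscreteValuationRing V]
  {K : Type*} [Field K] [Algebra V K] [IsFractionRing V K] {ϖ : V}
  {W : Type*} [CommRing W] [Algebra V W] [Algebra K W] [IsScalarTower V K W]

/-- Let `S` be a subalgebra of finite type of a `K`-algebra `W` with `W = K · S`. Then
`K ⊗ dagger S` is a bornological `K`-algebra, and it is the completion of `W` with
respect to the bornology of linear growth. -/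
theorem isCompletion_tensor_dagger_subalgebra (hϖ : Irreducible ϖ) (S : Subalgebra V W)
    {G : Submodule V W} (hG : G.FG) (h1 : (1 : W) ∈ G) (hGS : G ≤ Subalgebra.toSubmodule S)
    (hgen : ∀ x ∈ S, ∃ n, x ∈ G ^ n) (hS : ∀ x : W, ∃ k : ℕ, algebraMap V K ϖ ^ k • x ∈ S)
    (ι : W →ₗ[K] K ⊗[V] dagger ϖ S) (hι : ∀ a : S, ι a = 1 ⊗ₜ toDagger ϖ S a)
    {B : ConvexBornology V W}
    (hB : ∀ X, B.Bounded X ↔ ∃ k c : ℕ, ∀ x ∈ X, ϖ ^ k • x ∈ linearGrowth ϖ G c) :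
    IsVectorSpaceBornology K ϖ ((ConvexBornology.fine V K).tensor (daggerBornology ϖ S)) ∧
    IsAlgebraBornology ((ConvexBornology.fine V K).tensor (daggerBornology ϖ S)) ∧
    IsCompletion.{w} ϖ B ((ConvexBornology.fine V K).tensor (daggerBornology ϖ S))
      (ι.restrictScalars V) := by
  -- Generators are regarded inside the subalgebra, where the Monsky–Washnitzer completion is
  -- formed; the inclusion carries linear growth for `F` onto linear growth for `G`.
  let F : Submodule V S := G.comap S.val.toLinearMap
  have hmap : F.map S.val.toLinearMap = G :=
    Submodule.map_comap_eq_self fun x hx => ⟨⟨x, hGS hx⟩, rfl⟩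
  have hF : F.FG := Submodule.fg_of_fg_map_injective S.val.toLinearMap Subtype.val_injective
    (hmap.symm ▸ hG)
  have hgenF : ∀ x, ∃ n, x ∈ F ^ n := fun x => by
    obtain ⟨n, hn⟩ := hgen x x.2
    rw [← hmap, ← Submodule.map_pow] at hn
    obtain ⟨y, hy, e⟩ := hn
    exact ⟨n, Subtype.val_injective e ▸ hy⟩
  have h1F : (1 : S) ∈ F := h1
  have htf : ∀ x : S, ϖ • x = 0 → x = 0 := fun x hx => by
    have h : ϖ • (x : W) = 0 := congrArg Subtype.val hx
    rw [← algebraMap_smul K ϖ] at h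
    exact Subtype.ext
      ((IsUnit.mk0 _ (algebraMap_uniformizer_ne_zero K hϖ)).smul_eq_zero.1 h)
  refine ⟨isVectorSpaceBornology_tensor_dagger hϖ hF h1F hgenF,
    isAlgebraBornology_tensor_dagger hϖ hF h1F hgenF,
    isCompletion_tensor_dagger hϖ hF h1F hgenF htf S.val.toLinearMap (fun x => ?_) ι hι
      fun X => (hB X).trans ?_⟩
  · obtain ⟨k, hk⟩ := hS x
    exact ⟨k, ⟨_, hk⟩, rfl⟩
  · refine exists_congr fun k => exists_congr fun c => forall₂_congr fun x _ => ?_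
    rw [← hmap, ← map_linearGrowth, Submodule.mem_map, ← map_pow, algebraMap_smul]
    exact exists_congr fun y => and_congr_right fun _ => eq_comm

end Subalgebra

/-! ### The bornology attached to `J` and `α` is that of linear growth. -/

section Bornology

theorem IsVectorSpaceBornology.of_pow_smul {V : Type*} [CommRing V] [IsDomain V] {K : Type*}
    [Field K] [Algebra V K] [IsFractionRing V K] {ϖ : V} (hϖ : Irreducible ϖ)
    {X : Type*} [AddCommGroup X] [Module V X] [Module K X] [IsScalarTower V K X] {C : ConvexBornology V X}
    (hC : IsVectorSpaceBornology K ϖ C) {S : Set X} (hS : C.Bounded S) {k : ℕ} {T : Set X}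
    (hT : ∀ x ∈ T, ϖ ^ k • x ∈ S) : C.Bounded T := by
  induction k generalizing T with
  | zero => exact hS.subset fun x hx => by simpa using hT x hx
  | succ k ih =>
    refine (hC _ (ih (T := ϖ • T) ?_)).subset fun x hx =>
      ⟨ϖ • x, Set.smul_mem_smul_set hx, ?_⟩
    · rintro _ ⟨x, hx, rfl⟩
      dsimp only
      rw [← mul_smul, ← pow_succ]
      exact hT x hx
    · dsimp only
      rw [← algebraMap_smul K ϖ x, inv_smul_smul₀ (algebraMap_uniformizer_ne_zero K hϖ)]

variable {V : Type*} [CommRing V] [IsDomain V] [IsDiscreteValuationRing V]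
  (K : Type*) [Field K] [Algebra V K] [IsFractionRing V K] {ϖ : V}
  {R : Type*} [CommRing R] [Algebra V R] {α : ℝ} {q : ℕ} {N M : Submodule V R}

/-- The bornology on `R_K` generated by the submodules of linear growth. -/
noncomputable def growthBornology (hϖ : Irreducible ϖ) (h1 : (1 : R) ∈ N)
    (hgen : ∀ a, ∃ n, a ∈ N ^ n) (α : ℝ) (q : ℕ) (M : Submodule V R) :
    ConvexBornology V (K ⊗[V] R) :=
  ConvexBornology.ofBounded
    (fun S => ∃ k c : ℕ, ∀ x ∈ S,
      ϖ ^ k • x ∈ linearGrowth ϖ (tubeGenerators K ϖ α q N M) c)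
    ⟨0, 0, fun _ h => h.elim⟩
    (fun _ ⟨k, c, h⟩ _ hT => ⟨k, c, fun x hx => h x (hT hx)⟩)
    (fun _ ⟨k, c, h⟩ _ ⟨k', c', h'⟩ => ⟨k + k', max c c', fun x hx => hx.elim
      (fun hx => by
        rw [add_comm, pow_add, mul_smul]
        exact Submodule.smul_mem _ _ (linearGrowth_mono (one_mem_tubeGenerators h1)
          (le_max_left _ _) (h x hx)))
      (fun hx => by
        rw [pow_add, mul_smul]
        exact Submodule.smul_mem _ _ (linearGrowth_mono (one_mem_tubeGenerators h1)
          (le_max_right _ _) (h' x hx)))⟩)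
    (fun x => by
      obtain ⟨k, r, h⟩ := exists_pow_smul_eq_includeRight hϖ x
      obtain ⟨n, hn⟩ := hgen r
      refine ⟨k, n, fun y hy => ?_⟩
      rw [Set.mem_singleton_iff.1 hy, ← algebraMap_smul K, map_pow, h]
      have : (Algebra.TensorProduct.includeRight : R →ₐ[V] K ⊗[V] R) r ∈
          tubeGenerators K ϖ α q N M ^ (n * (0 + 1)) := by
        rw [zero_add, mul_one]
        refine pow_le_pow_left' imageK_le_tubeGenerators n ?_
        rw [← imageK_pow]
        exact ⟨r, hn, rfl⟩
      simpa using mem_linearGrowth (ϖ := ϖ) this)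
    (fun S ⟨k, c, h⟩ => ⟨k, c, fun x hx => by
      suffices Submodule.span V S ≤ (linearGrowth ϖ (tubeGenerators K ϖ α q N M) c).comap
        (ϖ ^ k • LinearMap.id) from this hx
      exact Submodule.span_le.2 h⟩)

variable {K}

theorem growthBornology_bounded_iff {hϖ : Irreducible ϖ} {h1 : (1 : R) ∈ N}
    {hgen : ∀ a, ∃ n, a ∈ N ^ n} {S : Set (K ⊗[V] R)} :
    (growthBornology K hϖ h1 hgen α q M).Bounded S ↔ ∃ k c : ℕ, ∀ x ∈ S,
      ϖ ^ k • x ∈ linearGrowth ϖ (tubeGenerators K ϖ α q N M) c :=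
  ConvexBornology.bounded_ofBounded_iff

variable {ε : ℝ}

/-- Linear growth defines a member of the family that is intersected, and its bounded subsets are
bounded in every member. -/
theorem alphaBornology_bounded_iff (hϖ : Irreducible ϖ) (hε0 : 0 < ε) (hε1 : ε < 1)
    (hN : N.FG) (hM : M.FG) (h1 : (1 : R) ∈ N) (hgen : ∀ a, ∃ n, a ∈ N ^ n)
    (hϖM : algebraMap V R ϖ ∈ Ideal.span (M : Set R)) (hα0 : 0 ≤ α) (hq : 0 < q) {a : ℤ}
    (ha : α * q = a) {S : Set (K ⊗[V] R)} :
    (alphaBornology K ϖ ε (ConvexBornology.fine V R) (Ideal.span (M : Set R)) α).Bounded S ↔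
      ∃ k c : ℕ, ∀ x ∈ S, ϖ ^ k • x ∈ linearGrowth ϖ (tubeGenerators K ϖ α q N M) c := by
  have hp := algebraMap_uniformizer_ne_zero K hϖ
  have hlog : ∀ t : ℝ, Real.logb ε (ε ^ t) = t := fun t => Real.logb_rpow hε0 hε1.ne
  rw [alphaBornology, ConvexBornology.inter, ConvexBornology.bounded_ofBounded_iff]
  constructor
  · intro hS
    refine growthBornology_bounded_iff.1
      (hS (growthBornology K hϖ h1 hgen α q M) ⟨fun T hT => ?_, fun P hPJ hP => ?_⟩)
    · obtain ⟨k, c, h⟩ := growthBornology_bounded_iff.1 hT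
      refine growthBornology_bounded_iff.2 ⟨k + 1, c, ?_⟩
      rintro _ ⟨x, hx, rfl⟩
      dsimp only
      rw [pow_succ, mul_smul, ← algebraMap_smul K ϖ, smul_inv_smul₀ hp]
      exact h x hx
    · rw [ConvexBornology.fine, ConvexBornology.bounded_ofBounded_iff] at hP
      obtain ⟨P', hP', hPP⟩ := hP
      obtain ⟨h, hh⟩ := exists_le_pow_mul_of_fg h1 hgen (Submodule.FG.of_le hP' hPP) hPJ
      refine bornSpectralRadius_le (by positivity) fun r hr => ?_
      have hr0 : 0 < r := (Real.rpow_pos_of_pos hε0 α).trans hr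
      have hlr : Real.logb ε r < α := by
        rw [← hlog α]
        exact (Real.logb_lt_logb_iff_of_base_lt_one hε0 hε1 hr0 (Real.rpow_pos_of_pos hε0 α)).2 hr
      obtain ⟨c, hc⟩ := exists_geomSum_le_linearGrowth hp h1 hq ha hlr hh
      exact growthBornology_bounded_iff.2 ⟨0, c, fun x hx => by simpa using hc hx⟩
  · rintro ⟨k, c, hS⟩ C ⟨hC, hρ⟩
    obtain ⟨e, δ, hδ, h⟩ := exists_linearGrowth_le_geomSum (M := M) hp h1 hq hα0 c
    have hr : ε ^ α < ε ^ (α - δ) :=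
      Real.rpow_lt_rpow_of_exponent_gt hε0 hε1 (sub_lt_self α hδ)
    -- The single submodule `N ^ e * M ⊔ ϖ • N ^ e`, contained in the ideal because `ϖ` is, tests
    -- the spectral radius condition at the radius `ε ^ (α - δ) > ε ^ α`.
    have hb := bounded_geomSum_of_bornSpectralRadius_le hp hε0 hε1 (by positivity)
      (hρ (N ^ e * M ⊔ ϖ • N ^ e) ?_ ?_) hr
    · refine hC.of_pow_smul hϖ hb (k := 4 + k) fun x hx => ?_
      have := h _ (hlog (α - δ)) _ (hS x hx)
      rwa [← map_pow, algebraMap_smul, ← mul_smul, ← pow_add] at this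
    · refine sup_le (Submodule.mul_le.2 fun u _ v hv => ?_) fun x hx => ?_
      · exact Ideal.mul_mem_left _ _ (Ideal.subset_span hv)
      · obtain ⟨y, -, rfl⟩ := (Submodule.mem_smul_pointwise_iff_exists _ _ _).1 hx
        rw [Algebra.smul_def]
        exact Ideal.mul_mem_right _ _ hϖM
    · rw [ConvexBornology.fine, ConvexBornology.bounded_ofBounded_iff]
      exact ⟨_, ((hN.pow e).mul hM).sup ((hN.pow e).map _), le_rfl⟩

end Bornology

/-! ### The tube algebra and the comparison map. -/

section Tube

variable {V : Type*} [CommRing V] [IsDomain V]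
  {K : Type*} [Field K] [Algebra V K] [IsFractionRing V K] {ϖ : V} (hϖ : Irreducible ϖ)
  {ε : ℝ} (hε0 : 0 < ε) (hε1 : ε < 1)
  {R : Type*} [CommRing R] [Algebra V R] {α : ℝ} {q : ℕ} {N M : Submodule V R}

theorem tubeGenerators_le_tube :
    tubeGenerators K ϖ α q N M ≤
      Subalgebra.toSubmodule (tube K hϖ hε0 hε1 (Ideal.span (M : Set R)) α) := by
  refine iSup₂_le fun l hl => le_trans ?_
    (le_iSup (tubeSummand K ϖ ε (Ideal.span (M : Set R)) α) l)
  rw [tubeSummand_eq K hε0 hε1]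
  refine scaledImage_mono _ (Submodule.mul_le.2 fun u _ v hv => ?_)
  refine Ideal.mul_mem_left _ _ ?_
  clear hl
  induction hv using Submodule.pow_induction_on_left' with
  | algebraMap r => simp
  | add x y i _ _ hx hy => exact add_mem hx hy
  | mem_mul m hm i x _ hx =>
    rw [Nat.succ_eq_add_one, pow_succ']
    exact Ideal.mul_mem_mul (Ideal.subset_span hm) hx

theorem exists_mem_tubeGenerators_pow (h1 : (1 : R) ∈ N) (hgen : ∀ a, ∃ n, a ∈ N ^ n)
    (hq : 0 < q) {a : ℤ} (ha : α * q = a) {x : K ⊗[V] R}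
    (hx : x ∈ tube K hϖ hε0 hε1 (Ideal.span (M : Set R)) α) :
    ∃ n, x ∈ tubeGenerators K ϖ α q N M ^ n := by
  have hp := algebraMap_uniformizer_ne_zero K hϖ
  change x ∈ ⨆ n : ℕ, tubeSummand K ϖ ε (Ideal.span (M : Set R)) α n at hx
  induction hx using Submodule.iSup_induction' with
  | mem n x hx =>
    rw [tubeSummand_eq K hε0 hε1] at hx
    obtain ⟨y, hy, rfl⟩ := mem_scaledImage.1 hx
    obtain ⟨h, hh⟩ := exists_mem_pow_mul_pow h1 hgen n hy
    exact ⟨_, scaledImage_le_tubeGenerators_pow hp h1 hq ha h n (mem_scaledImage.2 ⟨y, hh, rfl⟩)⟩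
  | zero => exact ⟨0, zero_mem _⟩
  | add x y _ _ hx hy =>
    obtain ⟨m, hm⟩ := hx
    obtain ⟨n, hn⟩ := hy
    have h1' := one_mem_tubeGenerators (K := K) (ϖ := ϖ) (α := α) (q := q) (M := M) h1
    exact ⟨max m n, add_mem (pow_le_pow_of_one_mem h1' (le_max_left _ _) hm)
      (pow_le_pow_of_one_mem h1' (le_max_right _ _) hn)⟩

theorem exists_pow_smul_mem_tube [IsDiscreteValuationRing V] {J : Ideal R} (x : K ⊗[V] R) :
    ∃ k : ℕ, algebraMap V K ϖ ^ k • x ∈ tube K hϖ hε0 hε1 J α := by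
  obtain ⟨k, r, h⟩ := exists_pow_smul_eq_includeRight hϖ x
  exact ⟨k, h ▸ (toTube K hϖ hε0 hε1 J α r).2⟩

/-- The comparison map is defined through `R`, but every element of the tube algebra becomes an
element of `R` after multiplication by some `ϖ ^ k`, which is invertible on the target. -/
theorem toTubeDagger_coe [IsDiscreteValuationRing V] {J : Ideal R} (x : tube K hϖ hε0 hε1 J α) :
    toTubeDagger K hϖ hε0 hε1 J α (x : K ⊗[V] R) = 1 ⊗ₜ toDagger ϖ _ x := by
  have hp := algebraMap_uniformizer_ne_zero K hϖ
  obtain ⟨k, r, h⟩ := exists_pow_smul_eq_includeRight hϖ (x : K ⊗[V] R)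
  have hr : toTube K hϖ hε0 hε1 J α r = ϖ ^ k • x := by
    refine Subtype.ext ?_
    rw [← map_pow, algebraMap_smul] at h
    exact h.symm
  refine (IsUnit.mk0 _ (pow_ne_zero k hp)).smul_left_cancel.1 ?_
  rw [← map_smul, h]
  have : toTubeDagger K hϖ hε0 hε1 J α
      ((Algebra.TensorProduct.includeRight : R →ₐ[V] K ⊗[V] R) r) =
        1 ⊗ₜ toDagger ϖ _ (toTube K hϖ hε0 hε1 J α r) := by
    simp [toTubeDagger]
  rw [this, hr, map_smul, TensorProduct.tmul_smul, ← map_pow, algebraMap_smul]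

end Tube

end BornTube

open BornTube in
theorem mainTheorem4 {V : Type*} [CommRing V] [IsDomain V] [IsDiscreteValuationRing V]
    [IsAdicComplete (IsLocalRing.maximalIdeal V) V]
    {K : Type*} [Field K] [Algebra V K] [IsFractionRing V K]
    {ϖ : V} (hϖ : Irreducible ϖ) {ε : ℝ} (hε0 : 0 < ε) (hε1 : ε < 1)
    {R : Type*} [CommRing R] [Algebra V R] [Algebra.FiniteType V R]
    (J : Ideal R) (hJ : algebraMap V R ϖ ∈ J) (α : ℚ) (hα0 : 0 ≤ α) (hα1 : α ≤ 1) :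
    BornTube.IsVectorSpaceBornology K ϖ (BornTube.tubeDaggerBornology K hϖ hε0 hε1 J α) ∧
    BornTube.IsAlgebraBornology (BornTube.tubeDaggerBornology K hϖ hε0 hε1 J α) ∧
    BornTube.IsCompletion.{w} ϖ
      (BornTube.alphaBornology K ϖ ε (BornTube.ConvexBornology.fine V R) J α)
      (BornTube.tubeDaggerBornology K hϖ hε0 hε1 J α)
      ((BornTube.toTubeDagger K hϖ hε0 hε1 J α).toLinearMap.restrictScalars V) := by
  have : IsNoetherianRing R := Algebra.FiniteType.isNoetherianRing V R
  obtain ⟨N, hN, h1, hgen⟩ := exists_fg_submodule_forall_mem_pow (V := V) (R := R)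
  obtain ⟨M, hM, rfl⟩ := exists_fg_submodule_span_eq (V := V) J
  -- Rationality of `α` enters here: multiplication by the denominator makes it an integer, which
  -- gives finite generation of the tube algebra.
  have hq : 0 < α.den := α.den_pos
  have ha : (α : ℝ) * α.den = (α.num : ℤ) := by exact_mod_cast Rat.mul_den_eq_num α
  have hα : (0 : ℝ) ≤ α := by exact_mod_cast hα0
  have hfilt : ∀ x ∈ tube K hϖ hε0 hε1 (Ideal.span (M : Set R)) (α : ℝ), _ :=
    fun x => exists_mem_tubeGenerators_pow hϖ hε0 hε1 h1 hgen hq ha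
  have hle := tubeGenerators_le_tube (K := K) (α := α) (q := α.den) (N := N) (M := M) hϖ hε0 hε1
  have hB := fun X => alphaBornology_bounded_iff (K := K) (S := X) hϖ hε0 hε1 hN hM h1 hgen hJ hα
    hq ha
  have hcompl := isCompletion_tensor_dagger_subalgebra.{w} hϖ
    (tube K hϖ hε0 hε1 (Ideal.span (M : Set R)) α) (tubeGenerators_fg hN hM)
    (one_mem_tubeGenerators h1) hle hfilt (exists_pow_smul_mem_tube hϖ hε0 hε1)
    (toTubeDagger K hϖ hε0 hε1 (Ideal.span (M : Set R)) α).toLinearMap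
  have h := hcompl (toTubeDagger_coe hϖ hε0 hε1) hB
  unfold tubeDaggerBornology
  exact h
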